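/- Let $n\ge 0$ and $d\ge 1$ be integers and let $X_1,\dots,X_n$ be independent Rademacher random variables, i.e. $\mathbb P\{X_i=1\}=\mathbb P\{X_i=-1\}=1/2$. For $m\ge 0$ let $\mathcal I_{n,m}$ be the family of subsets of $\{1,\dots,n\}$ of size $m$ (empty if $m>n$), and let $\mathcal T$ be a nonempty compact set of real vectors $t=(t_I)_{I\in\mathcal I_{n,d}}$. Put $$Z=\sup_{t\in\mathcal T}\Bigl|\sum_{I\in\mathcal I_{n,d}}\Bigl(\prod_{i\in I}X_i\Bigr)t_I\Bigr|$$ and, for $1\le k\le d$, $$W_k=\sup_{t\in\mathcal T}\ \sup_{\substack{\alpha^{(1)},\dots,\alpha^{(k)}\in\mathbb R^n\\ \|\alpha^{(h)}\|_2\le 1}}\Bigl|\sum_{J\in\mathcal I_{n,d-k}}\Bigl(\prod_{j\in J}X_j\Bigr)\sum_{\substack{(i_1,\dots,i_k)\in\{1,\dots,n\}^k\\ \{i_1,\dots,i_k\}\cup J\in\mathcal I_{n,d}}}\Bigl(\prod_{h=1}^k\alpha^{(h)}_{i_h}\Bigr)t_{\{i_1,\dots,i_k\}\cup J}\Bigr|,$$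 so that $W_d$ is a constant not depending on the $X_i$. Let $\kappa=\frac{\sqrt e}{2(\sqrt e-1)}$, $K=\frac1{e-\sqrt e}$, $x_+=\max(x,0)$ and $\|Y\|_q=(\mathbb E|Y|^q)^{1/q}$. Then $Z$ and $W_1,\dots,W_d$ are integrable, and for every real $q\ge 2$ the variable $(Z-\mathbb E Z)_+$ is in $L_q$ and $$\|(Z-\mathbb E Z)_+\|_q\le\sum_{j=1}^{d-1}(4\kappa q)^{j/2}\,\mathbb E W_j+(4\kappa)^{(d-1)/2}\sqrt{2K}\,q^{d/2}\,W_d\le\sum_{j=1}^{d}(4\kappa q)^{j/2}\,\mathbb E W_j .$$ -/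

import Mathlib

open MeasureTheory ProbabilityTheory

namespace RademacherChaos

noncomputable section

/-- The constant `κ = √e / (2 (√e - 1))`. -/
def kappa : ℝ := √(Real.exp 1) / (2 * (√(Real.exp 1) - 1))

/-- The constant `K = 1 / (e - √e)`. -/
def bigK : ℝ := 1 / (Real.exp 1 - √(Real.exp 1))

/-- `X` is a Rademacher random variable: it is measurable and takes each of the
values `1` and `-1` with probability `1/2`. -/
def IsRademacher {Ω : Type*} [MeasurableSpace Ω] (μ : Measure Ω) (X : Ω → ℝ) : Prop :=
  Measurable X ∧ μ {ω | X ω = 1} = 1 / 2 ∧ μ {ω | X ω = -1} = 1 / 2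

/-- The `L_q` norm `(E |Y|^q)^(1/q)`. -/
def lqNorm {Ω : Type*} [MeasurableSpace Ω] (μ : Measure Ω) (q : ℝ) (Y : Ω → ℝ) : ℝ :=
  (∫ ω, |Y ω| ^ q ∂μ) ^ (1 / q)

/-- The family of subsets of `{1, …, n}` of size `d`. -/
abbrev Idx (n d : ℕ) : Type := {I : Finset (Fin n) // I.card = d}

/-- The Rademacher chaos `∑_I (∏_{i ∈ I} x_i) t_I` of order `d` with coefficients `t`. -/
def chaos {n d : ℕ} (t : Idx n d → ℝ) (x : Fin n → ℝ) : ℝ :=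
  ∑ I : Idx n d, (∏ i ∈ I.1, x i) * t I

/-- The supremum `Z` over `t ∈ T` of the absolute value of the chaos, as a function of
the signs `x`. -/
def supChaos {n d : ℕ} (T : Set (Idx n d → ℝ)) (x : Fin n → ℝ) : ℝ :=
  sSup {r | ∃ t ∈ T, r = |chaos t x|}

/-- The partially decoupled chaos
`∑_J (∏_{j ∈ J} x_j) ∑_{i_1, …, i_k} (∏_h α^(h)_{i_h}) t_{{i_1, …, i_k} ∪ J}`,
where `J` runs over the sets of size `d - k` and `(i_1, …, i_k)` over the tuples for which
`{i_1, …, i_k} ∪ J` has size `d`. -/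
def mixedChaos {n d : ℕ} (k : ℕ) (t : Idx n d → ℝ)
    (α : Fin k → EuclideanSpace ℝ (Fin n)) (x : Fin n → ℝ) : ℝ :=
  ∑ J : Idx n (d - k), (∏ j ∈ J.1, x j) *
    ∑ i : {i : Fin k → Fin n // (Finset.univ.image i ∪ J.1).card = d},
      (∏ h, α h (i.1 h)) * t ⟨Finset.univ.image i.1 ∪ J.1, i.2⟩

/-- `W_k`: the supremum over `t ∈ T` and over `α^(1), …, α^(k)` in the Euclidean unit ball
of the absolute value of the partially decoupled chaos (used for `1 ≤ k ≤ d`). -/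
def supMixed {n d : ℕ} (T : Set (Idx n d → ℝ)) (k : ℕ) (x : Fin n → ℝ) : ℝ :=
  sSup {r | ∃ t ∈ T, ∃ α : Fin k → EuclideanSpace ℝ (Fin n),
    (∀ h, ‖α h‖ ≤ 1) ∧ r = |mixedChaos k t α x|}

end

end RademacherChaos

open scoped BigOperators

/-! The proof combines the entropy method with an induction on the order of the chaos. For `φ x = x
^ p` with `1 ≤ p ≤ 2`, the entropy of a pair is jointly convex, so entropy on the cube is at most
the sum over coordinates of averaged pair entropies (`expect_comp_le_add_sum_pairEntropy`). Taking
`p = r / (r - 1)` and the variable `Y ^ (r - 1)`, where `Y` is the positive part of `Z - 𝔼 Z`,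
bounds the `r`-th moment of `Y` by its `(r - 1)`-th moment and `𝔼 (V₊ * Y ^ (r - 2))`.

Solving this recursion gives `‖Y‖_q ≤ √(2κq) ‖√V₊‖_q` in general (`expect_posDev_rpow_le_kappa`) and
`‖Y‖_q ≤ √(Kqc)` when `V₊ ≤ c` (`expect_posDev_rpow_le_bigK`).

A chaos is affine in each variable, so flipping a sign changes it by twice a partial derivative.
Freezing a maximizing `t` gives `V₊ ≤ 2 W₁²` (`upperVar_supChaos_le`), since `W₁` is the supremum
over `t` of the gradient norm.

Finally `W₁` is itself the supremum of a chaos of order one less, over the compact set of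
contractions of `T` with unit-ball vectors, and its own `W_k` is the original `W_{k+1}`
(`supMixed_succ`). Hence `‖W₁‖_q ≤ 𝔼 W₁ + ‖(W₁ - 𝔼 W₁)₊‖_q` can be iterated. Each step costs
`√(4κq)`; the last, where `W_d` is deterministic, costs only `√(2Kq)`. -/

namespace RademacherChaos

/-! ### Convexity of power entropies on two points -/

/-- The entropy, relative to the function `φ`, of the uniform distribution on two points. -/
noncomputable def pairEntropy (φ : ℝ → ℝ) (a b : ℝ) : ℝ :=
  (φ a + φ b) / 2 - φ ((a + b) / 2)

lemma pairEntropy_comm (φ : ℝ → ℝ) (a b : ℝ) : pairEntropy φ a b = pairEntropy φ b a := by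
  simp only [pairEntropy, add_comm]

lemma sq_add_div_add_le {u v P Q : ℝ} (hP : 0 < P) (hQ : 0 < Q) :
    (u + v) ^ 2 / (P + Q) ≤ u ^ 2 / P + v ^ 2 / Q := by
  rw [div_add_div _ _ hP.ne' hQ.ne', div_le_div_iff₀ (by positivity) (by positivity)]
  nlinarith [sq_nonneg (u * Q - v * P), mul_pos hP hQ]

lemma half_add_rpow_le {A B θ : ℝ} (hA : 0 ≤ A) (hB : 0 ≤ B) (h0 : 0 ≤ θ) (h1 : θ ≤ 1) :
    (A ^ θ + B ^ θ) / 2 ≤ ((A + B) / 2) ^ θ := by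
  have := (Real.concaveOn_rpow h0 h1).2 (Set.mem_Ici.2 hA) (Set.mem_Ici.2 hB)
    (show (0 : ℝ) ≤ 1 / 2 by norm_num) (show (0 : ℝ) ≤ 1 / 2 by norm_num) (by norm_num)
  simp only [smul_eq_mul] at this
  rw [← mul_add, ← mul_add, one_div_mul_eq_div, one_div_mul_eq_div] at this
  exact this

/-- Concavity of `x ^ (2 - p)` replaces the power of the mean by the mean of the powers; what
remains is joint convexity of `u ^ 2 / P`. -/
lemma rpow_second_derivative_nonneg {A B u v p : ℝ} (hA : 0 < A) (hB : 0 < B) (hp1 : 1 ≤ p)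
    (hp2 : p ≤ 2) :
    ((u + v) / 2) ^ 2 * ((A + B) / 2) ^ (p - 2) ≤
      (u ^ 2 * A ^ (p - 2) + v ^ 2 * B ^ (p - 2)) / 2 := by
  have e : p - 2 = -(2 - p) := by ring
  have hM : 0 < (A + B) / 2 := by positivity
  rw [e, Real.rpow_neg hA.le, Real.rpow_neg hB.le, Real.rpow_neg hM.le]
  have hP : 0 < A ^ (2 - p) := Real.rpow_pos_of_pos hA _
  have hQ : 0 < B ^ (2 - p) := Real.rpow_pos_of_pos hB _
  have hc := half_add_rpow_le hA.le hB.le (θ := 2 - p) (by linarith) (by linarith)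
  have h1 := sq_add_div_add_le (u := u) (v := v) hP hQ
  have h2 : ((u + v) / 2) ^ 2 * (((A + B) / 2) ^ (2 - p))⁻¹ ≤
      ((u + v) / 2) ^ 2 * ((A ^ (2 - p) + B ^ (2 - p)) / 2)⁻¹ := by
    gcongr
  refine h2.trans ?_
  have : ((u + v) / 2) ^ 2 * ((A ^ (2 - p) + B ^ (2 - p)) / 2)⁻¹ =
      ((u + v) ^ 2 / (A ^ (2 - p) + B ^ (2 - p))) / 2 := by
    field_simp
  rw [this]
  simp only [div_eq_mul_inv] at h1 ⊢
  linarith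

lemma pairEntropy_rpow_convex_pos {p : ℝ} (hp1 : 1 ≤ p) (hp2 : p ≤ 2) {a b u v : ℝ}
    (ha : 0 < a) (hb : 0 < b) (hau : 0 < a + u) (hbv : 0 < b + v) :
    ConvexOn ℝ (Set.Icc 0 1)
      (fun l : ℝ => pairEntropy (fun x => x ^ p) (a + l * u) (b + l * v)) := by
  have pos : ∀ l ∈ Set.Icc (0 : ℝ) 1, ∀ {a u : ℝ}, 0 < a → 0 < a + u → 0 < a + l * u := by
    rintro l ⟨h0, h1⟩ a u ha hau
    rcases eq_or_lt_of_le h0 with rfl | h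
    · simpa using ha
    · nlinarith
  have lin : ∀ (a u l : ℝ), HasDerivAt (fun l : ℝ => a + l * u) u l := fun a u l => by
    simpa using ((hasDerivAt_id l).mul_const u).const_add a
  have hmid : ∀ l : ℝ, (a + l * u + (b + l * v)) / 2 = (a + b) / 2 + l * ((u + v) / 2) :=
    fun l => by ring
  simp only [pairEntropy, hmid]
  have hM : 0 < (a + b) / 2 := by positivity
  have hMv : 0 < (a + b) / 2 + (u + v) / 2 := by linarith
  have der : ∀ l ∈ Set.Icc (0 : ℝ) 1, ∀ {a u : ℝ} (r : ℝ), 0 < a → 0 < a + u →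
      HasDerivAt (fun l : ℝ => (a + l * u) ^ r) (u * r * (a + l * u) ^ (r - 1)) l :=
    fun l hl a u r ha hau => (lin a u l).rpow_const (Or.inl (pos l hl ha hau).ne')
  refine convexOn_of_hasDerivWithinAt2_nonneg (convex_Icc 0 1)
    (f' := fun l => (u * p * (a + l * u) ^ (p - 1) + v * p * (b + l * v) ^ (p - 1)) / 2
      - ((u + v) / 2) * p * ((a + b) / 2 + l * ((u + v) / 2)) ^ (p - 1))
    (f'' := fun l => (u * p * (u * (p - 1) * (a + l * u) ^ (p - 1 - 1))
        + v * p * (v * (p - 1) * (b + l * v) ^ (p - 1 - 1))) / 2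
      - ((u + v) / 2) * p * (((u + v) / 2) * (p - 1) *
        ((a + b) / 2 + l * ((u + v) / 2)) ^ (p - 1 - 1))) ?_ ?_ ?_ ?_
  · have c : Continuous (fun x : ℝ => x ^ p) :=
      Real.continuous_rpow_const (by linarith)
    have c' : ∀ a u : ℝ, Continuous (fun l : ℝ => (a + l * u) ^ p) := fun a u =>
      c.comp (by fun_prop)
    exact ((((c' a u).add (c' b v)).div_const 2).sub (c' _ _)).continuousOn
  · intro l hl
    have hl' := interior_subset hl
    exact ((((der l hl' p ha hau).add (der l hl' p hb hbv)).div_const 2).sub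
      (der l hl' p hM hMv)).hasDerivWithinAt
  · intro l hl
    have hl' := interior_subset hl
    exact (((((der l hl' (p - 1) ha hau).const_mul (u * p)).add
      ((der l hl' (p - 1) hb hbv).const_mul (v * p))).div_const 2).sub
      ((der l hl' (p - 1) hM hMv).const_mul ((u + v) / 2 * p))).hasDerivWithinAt
  · intro l hl
    have hl' := interior_subset hl
    have key := rpow_second_derivative_nonneg (u := u) (v := v)
      (pos l hl' ha hau) (pos l hl' hb hbv) hp1 hp2
    rw [hmid, show p - 2 = p - 1 - 1 by ring] at key
    have := mul_le_mul_of_nonneg_left key (show 0 ≤ p * (p - 1) by nlinarith)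
    nlinarith

lemma convexOn_pairEntropy_rpow {p : ℝ} (hp1 : 1 ≤ p) (hp2 : p ≤ 2) :
    ConvexOn ℝ (Set.Ici (0 : ℝ) ×ˢ Set.Ici (0 : ℝ))
      (fun z => pairEntropy (fun x => x ^ p) z.1 z.2) := by
  refine ⟨(convex_Ici 0).prod (convex_Ici 0), ?_⟩
  rintro ⟨a, b⟩ ⟨ha, hb⟩ ⟨c, d⟩ ⟨hc, hd⟩ w l hw hl hwl
  simp only [Set.mem_Ici] at ha hb hc hd
  obtain rfl : w = 1 - l := by linarith
  simp only [Prod.smul_mk, Prod.mk_add_mk, smul_eq_mul]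
  have cont : Continuous (fun x : ℝ => x ^ p) := Real.continuous_rpow_const (by linarith)
  have hcont : Continuous (fun z : ℝ × ℝ => pairEntropy (fun x => x ^ p) z.1 z.2) := by
    unfold pairEntropy
    have h1 := cont.comp (continuous_fst (X := ℝ) (Y := ℝ))
    have h2 := cont.comp (continuous_snd (X := ℝ) (Y := ℝ))
    have h3 := cont.comp (show Continuous (fun z : ℝ × ℝ => (z.1 + z.2) / 2) by fun_prop)
    exact ((h1.add h2).div_const 2).sub h3
  -- The second derivative needs positive arguments; shifting by `ε` and letting `ε → 0` reaches the
  -- boundary of the quadrant.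
  have shift : ∀ x y : ℝ, Filter.Tendsto
      (fun ε : ℝ => pairEntropy (fun x => x ^ p) (x + ε) (y + ε)) (nhdsWithin 0 (Set.Ioi 0))
      (nhds (pairEntropy (fun x => x ^ p) x y)) := by
    intro x y
    have : Continuous (fun ε : ℝ => pairEntropy (fun x => x ^ p) (x + ε) (y + ε)) :=
      hcont.comp (show Continuous (fun ε : ℝ => (x + ε, y + ε)) by fun_prop)
    simpa using (this.tendsto 0).mono_left nhdsWithin_le_nhds
  refine le_of_tendsto_of_tendsto (shift _ _) (((shift a b).const_mul (1 - l)).add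
    ((shift c d).const_mul l)) ?_
  filter_upwards [self_mem_nhdsWithin] with ε hε
  rw [Set.mem_Ioi] at hε
  have := (pairEntropy_rpow_convex_pos hp1 hp2 (a := a + ε) (b := b + ε) (u := c - a) (v := d - b)
    (by linarith) (by linarith) (by linarith) (by linarith)).2
    (show (0 : ℝ) ∈ Set.Icc (0 : ℝ) 1 by simp) (show (1 : ℝ) ∈ Set.Icc (0 : ℝ) 1 by simp)
    hw hl hwl
  simp only [smul_eq_mul] at this
  ring_nf at this ⊢
  exact this

/-- Concavity of `x ^ (p - 1)` bounds the midpoint term below by `(a + b) / 2` times the mean of `a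
^ (p - 1)` and `b ^ (p - 1)`; the right side is exactly what is left. -/
lemma pairEntropy_rpow_le {p a b : ℝ} (hp1 : 1 < p) (hp2 : p ≤ 2) (ha : 0 ≤ a) (hb : 0 ≤ b) :
    pairEntropy (fun x => x ^ p) a b ≤ (a - b) * (a ^ (p - 1) - b ^ (p - 1)) / 4 := by
  have split : ∀ x : ℝ, 0 ≤ x → x ^ p = x * x ^ (p - 1) := fun x hx => by
    rw [mul_comm, ← Real.rpow_add_one' hx (by linarith)]
    ring_nf
  have hm : 0 ≤ (a + b) / 2 := by positivity
  have hc := half_add_rpow_le ha hb (θ := p - 1) (by linarith) (by linarith)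
  have := mul_le_mul_of_nonneg_left hc hm
  simp only [pairEntropy]
  rw [split a ha, split b hb, split _ hm]
  nlinarith

lemma rpow_sub_rpow_le {s x y : ℝ} (hs : 1 ≤ s) (hy : 0 ≤ y) (hxy : y ≤ x) :
    x ^ s - y ^ s ≤ s * x ^ (s - 1) * (x - y) := by
  rcases eq_or_lt_of_le (hy.trans hxy) with h | hx
  · obtain rfl : x = 0 := h.symm
    obtain rfl : y = 0 := le_antisymm hxy hy
    simp
  have hb := one_add_mul_self_le_rpow_one_add (s := y / x - 1) (p := s)
    (by have : 0 ≤ y / x := by positivity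
        linarith) hs
  have e : (1 + (y / x - 1)) ^ s = y ^ s / x ^ s := by
    rw [← Real.div_rpow hy hx.le]; congr 1; ring
  rw [e, le_div_iff₀ (by positivity)] at hb
  have e2 : x ^ s = x ^ (s - 1) * x := by
    rw [← Real.rpow_add_one hx.ne']; congr 1; ring
  have e3 : (y / x - 1) * x = y - x := by field_simp
  have e4 : (1 + s * (y / x - 1)) * x ^ s = x ^ s + s * x ^ (s - 1) * ((y / x - 1) * x) := by
    rw [e2]; ring
  rw [e4, e3] at hb
  linarith

/-! ### Norm inequalities for uniform averages -/

section Averages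

variable {ι : Type*} [Fintype ι]

lemma expect_eq_sum_weights (f : ι → ℝ) :
    𝔼 i, f i = ∑ i, (Fintype.card ι : ℝ)⁻¹ * f i := by
  rw [Fintype.expect_eq_sum_div_card, Finset.sum_div]
  exact Finset.sum_congr rfl fun i _ => by rw [div_eq_inv_mul]

variable [Nonempty ι]

lemma sum_weights_eq_one : ∑ _i : ι, (Fintype.card ι : ℝ)⁻¹ = 1 := by
  simp

lemma rpow_expect_le {f : ι → ℝ} (hf : ∀ i, 0 ≤ f i) {p : ℝ} (hp : 1 ≤ p) :
    (𝔼 i, f i) ^ p ≤ 𝔼 i, f i ^ p := by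
  rw [expect_eq_sum_weights, expect_eq_sum_weights]
  exact Real.rpow_arith_mean_le_arith_mean_rpow _ _ _ (fun _ _ => by positivity)
    sum_weights_eq_one (fun i _ => hf i) hp

lemma expect_rpow_le_rpow {f : ι → ℝ} (hf : ∀ i, 0 ≤ f i) {r q : ℝ} (hr : 0 < r)
    (hrq : r ≤ q) : 𝔼 i, f i ^ r ≤ (𝔼 i, f i ^ q) ^ (r / q) := by
  have hq : 0 < q := hr.trans_le hrq
  have h := rpow_expect_le (f := fun i => f i ^ r) (fun i => Real.rpow_nonneg (hf i) _)
    (p := q / r) ((one_le_div hr).2 hrq)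
  have e : ∀ i, (f i ^ r) ^ (q / r) = f i ^ q := fun i => by
    rw [← Real.rpow_mul (hf i), mul_div_cancel₀ _ hr.ne']
  simp only [e] at h
  have h0 : 0 ≤ 𝔼 i, f i ^ r :=
    Finset.expect_nonneg fun i _ => Real.rpow_nonneg (hf i) _
  have := Real.rpow_le_rpow (Real.rpow_nonneg h0 _) h (show 0 ≤ r / q by positivity)
  rwa [← Real.rpow_mul h0, div_mul_div_cancel₀ hr.ne', div_self hq.ne', Real.rpow_one] at this

lemma expect_mul_le_rpow_mul_rpow {f g : ι → ℝ} (hf : ∀ i, 0 ≤ f i) (hg : ∀ i, 0 ≤ g i)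
    {p q : ℝ} (hpq : p.HolderConjugate q) :
    𝔼 i, f i * g i ≤ (𝔼 i, f i ^ p) ^ (1 / p) * (𝔼 i, g i ^ q) ^ (1 / q) := by
  have h := Real.inner_le_Lp_mul_Lq_of_nonneg Finset.univ hpq (f := f) (g := g)
    (fun i _ => hf i) (fun i _ => hg i)
  simp only [Fintype.expect_eq_sum_div_card]
  set N : ℝ := (Fintype.card ι : ℝ) with hN
  have hNpos : 0 < N := by simp [hN, Fintype.card_pos]
  have hsf : 0 ≤ ∑ i, f i ^ p := Finset.sum_nonneg fun i _ => Real.rpow_nonneg (hf i) _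
  have hsg : 0 ≤ ∑ i, g i ^ q := Finset.sum_nonneg fun i _ => Real.rpow_nonneg (hg i) _
  rw [Real.div_rpow hsf hNpos.le, Real.div_rpow hsg hNpos.le, div_mul_div_comm,
    ← Real.rpow_add hNpos, one_div, one_div, hpq.inv_add_inv_eq_one, Real.rpow_one]
  rw [← one_div, ← one_div]
  gcongr

lemma rpow_expect_add_le {f g : ι → ℝ} (hf : ∀ i, 0 ≤ f i) (hg : ∀ i, 0 ≤ g i)
    {p : ℝ} (hp : 1 ≤ p) :
    (𝔼 i, (f i + g i) ^ p) ^ (1 / p) ≤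
      (𝔼 i, f i ^ p) ^ (1 / p) + (𝔼 i, g i ^ p) ^ (1 / p) := by
  have h := Real.Lp_add_le_of_nonneg Finset.univ hp (f := f) (g := g)
    (fun i _ => hf i) (fun i _ => hg i)
  simp only [Fintype.expect_eq_sum_div_card]
  have hN : (0 : ℝ) ≤ (Fintype.card ι : ℝ) := by positivity
  have hs : ∀ f : ι → ℝ, (∀ i, 0 ≤ f i) → 0 ≤ ∑ i, f i ^ p := fun f hf =>
    Finset.sum_nonneg fun i _ => Real.rpow_nonneg (hf i) _
  rw [Real.div_rpow (hs _ hf) hN, Real.div_rpow (hs _ hg) hN,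
    Real.div_rpow (hs (fun i => f i + g i) fun i => add_nonneg (hf i) (hg i)) hN, ← add_div]
  gcongr

end Averages

/-! ### Tensorization and the moment recursion on the cube -/

section Cube

variable {n : ℕ}

/-- Flip the `i`-th bit. -/
def flip (i : Fin n) (s : Fin n → Bool) : Fin n → Bool := Function.update s i (!s i)

lemma flip_flip (i : Fin n) (s : Fin n → Bool) : flip i (flip i s) = s := by
  simp [flip]

lemma expect_flip (i : Fin n) (f : (Fin n → Bool) → ℝ) :
    𝔼 s, f (flip i s) = 𝔼 s, f s :=
  Fintype.expect_equiv ⟨flip i, flip i, flip_flip i, flip_flip i⟩ _ _ fun _ => rfl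

lemma expect_cube_succ (f : (Fin (n + 1) → Bool) → ℝ) :
    𝔼 s, f s = (𝔼 s, f (Fin.cons true s) + 𝔼 s, f (Fin.cons false s)) / 2 := by
  have h : ∑ s, f s = ∑ s, f (Fin.cons true s) + ∑ s, f (Fin.cons false s) := by
    rw [← (Fin.consEquiv (fun _ : Fin (n + 1) => Bool)).sum_comp, Fintype.sum_prod_type,
      Fintype.sum_bool]
    rfl
  simp only [Fintype.expect_eq_sum_div_card, h, Fintype.card_fun, Fintype.card_bool,
    Fintype.card_fin]
  push_cast
  rw [pow_succ]
  field_simp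

lemma flip_zero_cons (b : Bool) (s : Fin n → Bool) :
    flip 0 (Fin.cons b s : Fin (n + 1) → Bool) = Fin.cons (!b) s := by
  simp [flip]

lemma flip_succ_cons (b : Bool) (i : Fin n) (s : Fin n → Bool) :
    flip i.succ (Fin.cons b s : Fin (n + 1) → Bool) = Fin.cons b (flip i s) := by
  simp only [flip, Fin.cons_succ, Fin.cons_update]

/-- Tensorization of the entropy relative to `φ`, on the discrete cube. -/
theorem expect_comp_le_add_sum_pairEntropy {S : Set ℝ} {φ : ℝ → ℝ}
    (hS : Convex ℝ S)
    (hφ : ConvexOn ℝ (S ×ˢ S) (fun z => pairEntropy φ z.1 z.2)) :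
    ∀ (n : ℕ) (Y : (Fin n → Bool) → ℝ), (∀ s, Y s ∈ S) →
      𝔼 s, φ (Y s) ≤ φ (𝔼 s, Y s) + ∑ i, 𝔼 s, pairEntropy φ (Y s) (Y (flip i s)) := by
  intro n
  induction n with
  | zero => intro Y _; simp
  | succ n ih =>
    intro Y hY
    have hmem : ∀ b : Bool, 𝔼 s : Fin n → Bool, Y (Fin.cons b s) ∈ S := fun b => by
      rw [expect_eq_sum_weights]
      exact hS.sum_mem (fun _ _ => by positivity) sum_weights_eq_one fun s _ => hY _
    -- The only use of convexity: the entropy of the two conditional means is at most the averaged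
    -- entropy along the first coordinate.
    have jensen : pairEntropy φ (𝔼 s : Fin n → Bool, Y (Fin.cons true s))
        (𝔼 s : Fin n → Bool, Y (Fin.cons false s)) ≤
        𝔼 s : Fin n → Bool, pairEntropy φ (Y (Fin.cons true s)) (Y (Fin.cons false s)) := by
      have := hφ.map_sum_le (t := Finset.univ) (w := fun _ : Fin n → Bool =>
        (Fintype.card (Fin n → Bool) : ℝ)⁻¹)
        (p := fun s => (Y (Fin.cons true s), Y (Fin.cons false s)))
        (fun _ _ => by positivity) sum_weights_eq_one (fun s _ => ⟨hY _, hY _⟩)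
      simp only [Prod.smul_mk, smul_eq_mul, Prod.fst_sum, Prod.snd_sum,
        ← expect_eq_sum_weights] at this
      exact this
    have h1 := ih (fun s => Y (Fin.cons true s)) fun _ => hY _
    have h0 := ih (fun s => Y (Fin.cons false s)) fun _ => hY _
    rw [Fin.sum_univ_succ, expect_cube_succ (fun s => φ (Y s)), expect_cube_succ Y,
      expect_cube_succ (fun s => pairEntropy φ (Y s) (Y (flip 0 s)))]
    simp only [flip_zero_cons, Bool.not_true, Bool.not_false]
    have e : ∑ i : Fin n, 𝔼 s, pairEntropy φ (Y s) (Y (flip i.succ s)) =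
        (∑ i : Fin n, 𝔼 s : Fin n → Bool, pairEntropy φ (Y (Fin.cons true s))
            (Y (Fin.cons true (flip i s))) +
          ∑ i : Fin n, 𝔼 s : Fin n → Bool, pairEntropy φ (Y (Fin.cons false s))
            (Y (Fin.cons false (flip i s)))) / 2 := by
      rw [← Finset.sum_add_distrib, Finset.sum_div]
      refine Finset.sum_congr rfl fun i _ => ?_
      rw [expect_cube_succ]
      simp only [flip_succ_cons]
    rw [e]
    have e2 : 𝔼 s : Fin n → Bool, pairEntropy φ (Y (Fin.cons false s)) (Y (Fin.cons true s)) =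
        𝔼 s : Fin n → Bool, pairEntropy φ (Y (Fin.cons true s)) (Y (Fin.cons false s)) :=
      Finset.expect_congr rfl fun s _ => pairEntropy_comm _ _ _
    rw [e2]
    simp only [pairEntropy] at jensen h1 h0 ⊢
    linarith

/-- The upper variance proxy `V₊ = ½ ∑ᵢ (Z - Zᵢ)₊²`. -/
noncomputable def upperVar (Z : (Fin n → Bool) → ℝ) (s : Fin n → Bool) : ℝ :=
  (∑ i, (max (Z s - Z (flip i s)) 0) ^ 2) / 2

lemma upperVar_nonneg (Z : (Fin n → Bool) → ℝ) (s : Fin n → Bool) : 0 ≤ upperVar Z s :=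
  div_nonneg (Finset.sum_nonneg fun _ _ => sq_nonneg _) zero_le_two

/-- The positive part of `Z` centred at its mean. -/
noncomputable def posDev (Z : (Fin n → Bool) → ℝ) (s : Fin n → Bool) : ℝ :=
  max (Z s - 𝔼 u, Z u) 0

lemma posDev_nonneg (Z : (Fin n → Bool) → ℝ) (s : Fin n → Bool) : 0 ≤ posDev Z s :=
  le_max_right _ _

/-- A flip is an involution preserving the uniform law, so both halves of a symmetrized term have
the same average. This turns two-sided increments into the one-sided ones of `upperVar`. -/
lemma sum_expect_symm (g : (Fin n → Bool) → (Fin n → Bool) → ℝ) :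
    ∑ i, 𝔼 s, (g s (flip i s) + g (flip i s) s) = 2 * 𝔼 s, ∑ i, g s (flip i s) := by
  rw [Finset.expect_sum_comm, Finset.mul_sum]
  refine Finset.sum_congr rfl fun i _ => ?_
  rw [Finset.expect_add_distrib, ← expect_flip i (fun s => g (flip i s) s)]
  simp only [flip_flip]
  ring

/-- The Efron-Stein inequality for the positive part. -/
lemma expect_posDev_sq_le (Z : (Fin n → Bool) → ℝ) :
    𝔼 s, posDev Z s ^ (2 : ℝ) ≤ 𝔼 s, upperVar Z s := by
  have hh : ∀ a b : ℝ, pairEntropy (fun x => x ^ 2) a b = (a - b) ^ 2 / 4 := fun a b => by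
    simp only [pairEntropy]; ring
  have hconv : ConvexOn ℝ (Set.univ ×ˢ Set.univ)
      (fun z : ℝ × ℝ => pairEntropy (fun x => x ^ 2) z.1 z.2) := by
    simp only [hh, Set.univ_prod_univ]
    refine ⟨convex_univ, ?_⟩
    rintro ⟨a, b⟩ - ⟨c, d⟩ - w l hw hl hwl
    obtain rfl : w = 1 - l := by linarith
    simp only [Prod.smul_mk, Prod.mk_add_mk, smul_eq_mul]
    nlinarith [mul_nonneg (mul_nonneg hw hl) (sq_nonneg (a - b - (c - d)))]
  have h := expect_comp_le_add_sum_pairEntropy convex_univ hconv n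
    (fun s => Z s - 𝔼 u, Z u) (fun _ => Set.mem_univ _)
  have h0 : 𝔼 s, (Z s - 𝔼 u, Z u) = 0 := by
    rw [Finset.expect_sub_distrib, Fintype.expect_const, sub_self]
  rw [h0] at h
  simp only [hh, sub_sub_sub_cancel_right] at h
  have h2 : ∑ i, 𝔼 s, (Z s - Z (flip i s)) ^ 2 / 4 = 𝔼 s, upperVar Z s := by
    have : ∀ a b : ℝ, (a - b) ^ 2 / 4 = max (a - b) 0 ^ 2 / 4 + max (b - a) 0 ^ 2 / 4 := by
      intro a b
      rcases le_total a b with h | h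
      · rw [max_eq_right (by linarith), max_eq_left (by linarith)]; ring
      · rw [max_eq_left (by linarith), max_eq_right (by linarith)]; ring
    simp only [this]
    rw [sum_expect_symm (fun s u => max (Z s - Z u) 0 ^ 2 / 4), Finset.mul_expect]
    refine Finset.expect_congr rfl fun s _ => ?_
    rw [upperVar, ← Finset.sum_div]
    ring
  rw [h2] at h
  refine le_trans (Finset.expect_le_expect fun s _ => ?_) (h.trans_eq (by norm_num))
  rw [Real.rpow_two, posDev]
  rcases le_total (Z s - 𝔼 u, Z u) 0 with h' | h'
  · rw [max_eq_right h']; nlinarith [sq_nonneg (Z s - 𝔼 u, Z u)]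
  · rw [max_eq_left h']

/-- The power difference is bounded by the slope at the larger endpoint, so only the term whose
increment is positive survives. -/
lemma rpow_sub_mul_sub_le {r a b : ℝ} (hr : 2 ≤ r) (ha : 0 ≤ a) (hb : 0 ≤ b) :
    (a ^ (r - 1) - b ^ (r - 1)) * (a - b) ≤
      (r - 1) * (a ^ (r - 2) * max (a - b) 0 ^ 2) +
        (r - 1) * (b ^ (r - 2) * max (b - a) 0 ^ 2) := by
  have key : ∀ a b : ℝ, 0 ≤ b → b ≤ a → (a ^ (r - 1) - b ^ (r - 1)) * (a - b) ≤
      (r - 1) * (a ^ (r - 2) * (a - b) ^ 2) := by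
    intro a b hb hab
    have := rpow_sub_rpow_le (s := r - 1) (by linarith) hb hab
    rw [show r - 1 - 1 = r - 2 by ring] at this
    have := mul_le_mul_of_nonneg_right this (sub_nonneg.2 hab)
    linarith
  rcases le_total b a with h | h
  · rw [max_eq_left (sub_nonneg.2 h), max_eq_right (sub_nonpos.2 h)]
    have := key a b hb h
    linarith
  · rw [max_eq_right (sub_nonpos.2 h), max_eq_left (sub_nonneg.2 h)]
    have := key b a ha h
    linarith

/-- The recursion on the moments of the positive part. -/
lemma expect_posDev_rpow_le (Z : (Fin n → Bool) → ℝ) {r : ℝ} (hr : 2 ≤ r) :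
    𝔼 s, posDev Z s ^ r ≤ (𝔼 s, posDev Z s ^ (r - 1)) ^ (r / (r - 1)) +
      (r - 1) * 𝔼 s, upperVar Z s * posDev Z s ^ (r - 2) := by
  set Y := posDev Z with hYdef
  have hY : ∀ s, 0 ≤ Y s := posDev_nonneg Z
  have hr1 : 0 < r - 1 := by linarith
  have hp1 : 1 < r / (r - 1) := by rw [lt_div_iff₀ hr1]; linarith
  have hp2 : r / (r - 1) ≤ 2 := by rw [div_le_iff₀ hr1]; linarith
  -- The exponent `r / (r - 1)` lies in `(1, 2]` because `r ≥ 2`, and it turns `Y ^ (r - 1)` into `Y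
  -- ^ r`.
  have h := expect_comp_le_add_sum_pairEntropy (convex_Ici 0)
    (convexOn_pairEntropy_rpow hp1.le hp2) n (fun s => Y s ^ (r - 1))
    (fun s => Real.rpow_nonneg (hY s) _)
  have e : ∀ s, (Y s ^ (r - 1)) ^ (r / (r - 1)) = Y s ^ r := fun s => by
    rw [← Real.rpow_mul (hY s), mul_div_cancel₀ _ hr1.ne']
  simp only [e] at h
  refine h.trans (add_le_add_right ?_ _)
  have e2 : ∀ s, (Y s ^ (r - 1)) ^ (r / (r - 1) - 1) = Y s := fun s => by
    rw [← Real.rpow_mul (hY s), mul_sub, mul_div_cancel₀ _ hr1.ne', mul_one, sub_sub_cancel,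
      Real.rpow_one]
  -- Truncation at the mean is nondecreasing and 1-Lipschitz, so positive increments do not grow.
  have hdiff : ∀ s u, max (Y s - Y u) 0 ≤ max (Z s - Z u) 0 := by
    intro s u
    simp only [hYdef, posDev]
    refine max_le ?_ (le_max_right _ _)
    rcases le_total (Z s - 𝔼 u, Z u) 0 with h' | h'
    · rw [max_eq_right h']
      exact le_max_of_le_right (by linarith [le_max_right (Z u - 𝔼 u, Z u) 0])
    · rw [max_eq_left h']
      exact le_max_of_le_left (by linarith [le_max_left (Z u - 𝔼 u, Z u) 0])
  have hpair : ∀ s u, pairEntropy (fun x => x ^ (r / (r - 1))) (Y s ^ (r - 1)) (Y u ^ (r - 1)) ≤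
      (r - 1) / 4 * (Y s ^ (r - 2) * max (Z s - Z u) 0 ^ 2) +
        (r - 1) / 4 * (Y u ^ (r - 2) * max (Z u - Z s) 0 ^ 2) := by
    intro s u
    refine (pairEntropy_rpow_le hp1 hp2 (Real.rpow_nonneg (hY s) _)
      (Real.rpow_nonneg (hY u) _)).trans ?_
    rw [e2, e2]
    have h1 := rpow_sub_mul_sub_le hr (hY s) (hY u)
    have mono : ∀ s u, (r - 1) * (Y s ^ (r - 2) * max (Y s - Y u) 0 ^ 2) ≤
        (r - 1) * (Y s ^ (r - 2) * max (Z s - Z u) 0 ^ 2) := fun s u => by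
      have h0 : 0 ≤ max (Y s - Y u) 0 := le_max_right _ _
      have h2 : 0 ≤ Y s ^ (r - 2) := Real.rpow_nonneg (hY s) _
      have h3 := hdiff s u
      gcongr
    linarith [mono s u, mono u s]
  refine (Finset.sum_le_sum fun i _ => Finset.expect_le_expect fun s _ =>
    hpair s (flip i s)).trans_eq ?_
  rw [sum_expect_symm (fun s u => (r - 1) / 4 * (Y s ^ (r - 2) * max (Z s - Z u) 0 ^ 2)),
    Finset.mul_expect, Finset.mul_expect]
  refine Finset.expect_congr rfl fun s _ => ?_
  rw [upperVar, ← Finset.mul_sum, ← Finset.mul_sum]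
  ring

end Cube

/-! ### The constants κ and K -/

section Constants

lemma sqrt_exp_one : √(Real.exp 1) = Real.exp (1 / 2) := by
  rw [Real.exp_half]

lemma exp_half_sq : Real.exp (1 / 2) * Real.exp (1 / 2) = Real.exp 1 := by
  rw [← Real.exp_add]; norm_num

lemma one_lt_exp_half : 1 < Real.exp (1 / 2) := by
  rw [Real.one_lt_exp_iff]; norm_num

lemma exp_neg_half : Real.exp (-(1 / 2)) = 1 / Real.exp (1 / 2) := by
  rw [Real.exp_neg, one_div (Real.exp _)]

lemma exp_half_bounds : 1.64 < Real.exp (1 / 2) ∧ Real.exp (1 / 2) < 1.66 := by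
  have h1 := Real.exp_one_gt_d9
  have h2 := Real.exp_one_lt_d9
  have h3 := exp_half_sq
  have h4 := one_lt_exp_half
  constructor <;> nlinarith

/-- This identity characterizes `κ`: the two terms of the recursion get weights `e^(-1/2)` and `1 /
(2κ)`, which sum to one. -/
lemma inv_two_mul_kappa : 1 / (2 * kappa) = 1 - Real.exp (-(1 / 2)) := by
  have h := one_lt_exp_half
  have h' : Real.exp (1 / 2) - 1 ≠ 0 := by linarith
  rw [kappa, sqrt_exp_one, exp_neg_half]
  field_simp

lemma half_lt_kappa : 1 / 2 < kappa := by
  have h := one_lt_exp_half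
  rw [kappa, sqrt_exp_one, lt_div_iff₀ (by linarith)]
  linarith

lemma kappa_pos : 0 < kappa := by linarith [half_lt_kappa]

lemma bigK_eq : bigK = 1 / (Real.exp (1 / 2) * (Real.exp (1 / 2) - 1)) := by
  rw [bigK, sqrt_exp_one, mul_sub, exp_half_sq, mul_one]

lemma bigK_pos : 0 < bigK := by
  have h := one_lt_exp_half
  rw [bigK_eq]
  exact div_pos one_pos (mul_pos (by linarith) (by linarith))

lemma inv_bigK : 1 / bigK = Real.exp 1 * (1 - Real.exp (-(1 / 2))) := by
  have h := one_lt_exp_half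
  rw [bigK_eq, exp_neg_half, ← exp_half_sq, one_div_one_div]
  field_simp

lemma bigK_le_two_mul_kappa : bigK ≤ 2 * kappa := by
  have h := one_lt_exp_half
  rw [bigK_eq, kappa, sqrt_exp_one]
  have h' : 0 < Real.exp (1 / 2) - 1 := by linarith
  rw [← mul_div_assoc, div_le_div_iff₀ (by positivity) (by positivity)]
  nlinarith [mul_pos h' h']

lemma one_sub_inv_rpow_le {r : ℝ} (hr : 1 < r) :
    ((r - 1) / r) ^ (r / 2) ≤ Real.exp (-(1 / 2)) := by
  have h0 : 0 < (r - 1) / r := div_pos (by linarith) (by linarith)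
  rw [Real.rpow_def_of_pos h0, Real.exp_le_exp]
  have h := Real.log_le_sub_one_of_pos h0
  have e : (r - 1) / r - 1 = -(1 / r) := by field_simp; ring
  rw [e] at h
  have := mul_le_mul_of_nonneg_right h (show 0 ≤ r / 2 by linarith)
  refine this.trans_eq ?_
  field_simp

lemma sum_pow_div_le_neg_log {x : ℝ} (h0 : 0 ≤ x) (h1 : x < 1) (k : ℕ) :
    ∑ i ∈ Finset.range k, x ^ (i + 1) / (i + 1) ≤ -Real.log (1 - x) :=
  sum_le_hasSum _ (fun _ _ => by positivity)
    (Real.hasSum_pow_div_log_of_abs_lt_one (by rwa [abs_of_nonneg h0]))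

/-- The numerical inequality behind the moment bound with bounded variations. -/
lemma moment_recursion_constant {r : ℝ} (hr : 4 ≤ r) :
    ((r - 1) / r) ^ (r / 2) +
      (1 / bigK) * ((r - 1) / r * ((r - 2) / r) ^ (r / 2 - 1)) ≤ 1 := by
  -- As `y = 1 / r → 0` the terms tend to `E = e^(-1/2)` and `1 - E`, so the inequality is tight in
  -- the limit and first-order corrections in `y` decide it.
  obtain ⟨y, hy, rfl⟩ : ∃ y : ℝ, y = 1 / r ∧ r = 1 / y := ⟨1 / r, rfl, by rw [one_div_one_div]⟩
  clear hy
  have hy0 : 0 < y := by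
    have : 0 < 1 / y := by linarith
    exact one_div_pos.1 this
  have hy4 : y ≤ 1 / 4 := by
    rw [le_div_iff₀ hy0] at hr; linarith
  have e1 : (1 / y - 1) / (1 / y) = 1 - y := by field_simp
  have e2 : (1 / y - 2) / (1 / y) = 1 - 2 * y := by field_simp
  rw [e1, e2]
  have l1 := sum_pow_div_le_neg_log hy0.le (by linarith) 2
  have l2 := sum_pow_div_le_neg_log (x := 2 * y) (by linarith) (by linarith) 3
  norm_num [Finset.sum_range_succ] at l1 l2
  have p1 : 0 < 1 - y := by linarith
  have p2 : 0 < 1 - 2 * y := by linarith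
  have b1 : (1 - y) ^ (1 / y / 2) ≤ Real.exp (-(1 / 2)) * Real.exp (-(y / 4)) := by
    rw [Real.rpow_def_of_pos p1, ← Real.exp_add, Real.exp_le_exp]
    have := mul_le_mul_of_nonneg_right (show Real.log (1 - y) ≤ -(y + y ^ 2 / 2) by linarith)
      (show 0 ≤ 1 / y / 2 by positivity)
    refine this.trans_eq ?_
    field_simp
    ring
  -- The logarithm is at most `-1 + y² / 6 + 8 y³ / 3`; applying `y ≤ 1/4` twice gives `-1 + 5y /
  -- 24`.
  have b2 : (1 - y) * (1 - 2 * y) ^ (1 / y / 2 - 1) ≤ Real.exp (-1) * Real.exp (5 * y / 24) := by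
    rw [Real.rpow_def_of_pos p2, ← Real.exp_add]
    nth_rewrite 1 [← Real.exp_log p1]
    rw [← Real.exp_add, Real.exp_le_exp]
    have h0 : 0 ≤ 1 / y / 2 - 1 := by
      rw [sub_nonneg, div_div, le_div_iff₀ (by positivity)]; linarith
    have := mul_le_mul_of_nonneg_right (show Real.log (1 - 2 * y) ≤
      -(2 * y + (2 * y) ^ 2 / 2 + (2 * y) ^ 3 / 3) by linarith) h0
    have e : -(2 * y + (2 * y) ^ 2 / 2 + (2 * y) ^ 3 / 3) * (1 / y / 2 - 1) =
        -1 + y + 2 / 3 * y ^ 2 + 8 / 3 * y ^ 3 := by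
      field_simp
      ring
    rw [e] at this
    nlinarith [mul_nonneg hy0.le (show 0 ≤ 1 / 4 - y by linarith),
      mul_nonneg (mul_nonneg hy0.le hy0.le) (show 0 ≤ 1 / 4 - y by linarith)]
  have ex : ∀ x : ℝ, x < 1 → Real.exp x ≤ 1 / (1 - x) := fun x hx => by
    have := Real.add_one_le_exp (-x)
    rw [Real.exp_neg] at this
    rw [le_div_iff₀ (by linarith)]
    calc Real.exp x * (1 - x) ≤ Real.exp x * (Real.exp x)⁻¹ := by
          gcongr; linarith
      _ = 1 := mul_inv_cancel₀ (Real.exp_pos _).ne'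
  -- The rate `23/100` lies between `5/24` and `1/4`; the loss on weight `E ≥ 1/2` then covers the
  -- gain on weight `1 - E`.
  have x1 : Real.exp (-(y / 4)) ≤ 1 - 23 / 100 * y := by
    refine (ex _ (by linarith)).trans ?_
    rw [div_le_iff₀ (by linarith)]
    nlinarith
  have x2 : Real.exp (5 * y / 24) ≤ 1 + 23 / 100 * y := by
    refine (ex _ (by linarith)).trans ?_
    rw [div_le_iff₀ (by linarith)]
    nlinarith
  have hE : 1 / 2 ≤ Real.exp (-(1 / 2)) := by
    rw [exp_neg_half]
    exact one_div_le_one_div_of_le (by positivity) (by linarith [exp_half_bounds.2])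
  have hE1 : Real.exp (-(1 / 2)) < 1 := by
    rw [Real.exp_lt_one_iff]; norm_num
  set E := Real.exp (-(1 / 2))
  rw [inv_bigK]
  have b3 : Real.exp 1 * (1 - E) * ((1 - y) * (1 - 2 * y) ^ (1 / y / 2 - 1)) ≤
      (1 - E) * (1 + 23 / 100 * y) := by
    calc _ ≤ Real.exp 1 * (1 - E) * (Real.exp (-1) * (1 + 23 / 100 * y)) := by
          have : 0 ≤ 1 - E := by linarith
          refine mul_le_mul_of_nonneg_left (b2.trans ?_) (by positivity)
          gcongr
      _ = (Real.exp 1 * Real.exp (-1)) * ((1 - E) * (1 + 23 / 100 * y)) := by ring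
      _ = _ := by rw [← Real.exp_add]; simp
  have b4 : E * Real.exp (-(y / 4)) ≤ E * (1 - 23 / 100 * y) := by gcongr
  nlinarith [mul_nonneg hy0.le (show 0 ≤ 2 * E - 1 by linarith)]

/-- The left side is the constant from interpolating between second moment `c` and fourth moment `9
c²`. Bounding `log (K r)` below by `2 - e / (K r)` makes the comparison of logarithms affine in `r`.
-/
lemma nine_rpow_le {r : ℝ} (h2 : 2 ≤ r) (h4 : r ≤ 4) :
    (9 : ℝ) ^ ((r - 2) / 2) ≤ (bigK * r) ^ (r / 2) := by
  have hK := bigK_pos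
  have hr : 0 < r := by linarith
  rw [Real.rpow_def_of_pos (by norm_num), Real.rpow_def_of_pos (by positivity), Real.exp_le_exp]
  have hlog9 : Real.log 9 ≤ 2.2 := by
    rw [Real.log_le_iff_le_exp (by norm_num)]
    have : Real.exp 2.2 = Real.exp 1 * Real.exp 1 * Real.exp 0.2 := by
      rw [← Real.exp_add, ← Real.exp_add]; norm_num
    rw [this]
    nlinarith [Real.exp_one_gt_d9, Real.quadratic_le_exp_of_nonneg (show (0 : ℝ) ≤ 0.2 by norm_num)]
  have hlow : 2 - Real.exp 1 / (bigK * r) ≤ Real.log (bigK * r) := by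
    have h := Real.one_sub_inv_le_log_of_pos (show 0 < bigK * r / Real.exp 1 by positivity)
    rw [Real.log_div (by positivity) (by positivity), Real.log_exp, inv_div] at h
    linarith
  have hconst : Real.exp 1 * (1 / bigK) ≤ 3.2 := by
    rw [bigK_eq, one_div_one_div]
    have h1 := Real.exp_one_lt_d9
    have h2 := exp_half_bounds
    have h3 := exp_half_sq
    have : Real.exp (1 / 2) * (Real.exp (1 / 2) - 1) ≤ 1.1 := by nlinarith
    nlinarith [Real.exp_pos 1]
  have e : Real.exp 1 / (bigK * r) * (r / 2) = Real.exp 1 * (1 / bigK) / 2 := by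
    field_simp
  have := mul_le_mul_of_nonneg_right hlow (show 0 ≤ r / 2 by positivity)
  rw [sub_mul, e] at this
  nlinarith

end Constants

/-! ### Solving the moment recursion -/

section MomentBounds

variable {n : ℕ}

lemma posDev_eq_zero_of_expect_upperVar_le {Z : (Fin n → Bool) → ℝ}
    (h : 𝔼 s, upperVar Z s ≤ 0) (s : Fin n → Bool) : posDev Z s = 0 := by
  have h1 := (expect_posDev_sq_le Z).trans h
  rw [Fintype.expect_eq_sum_div_card, div_le_iff₀ (by simp), zero_mul] at h1
  have h2 : ∀ u ∈ Finset.univ, 0 ≤ posDev Z u ^ (2 : ℝ) :=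
    fun u _ => Real.rpow_nonneg (posDev_nonneg Z u) _
  have h3 := (Finset.sum_eq_zero_iff_of_nonneg h2).1 (h1.antisymm (Finset.sum_nonneg h2)) s
    (Finset.mem_univ s)
  rwa [Real.rpow_two, sq_eq_zero_iff] at h3

lemma expect_posDev_rpow_eq_zero {Z : (Fin n → Bool) → ℝ}
    (h : 𝔼 s, upperVar Z s ≤ 0) {r : ℝ} (hr : r ≠ 0) : 𝔼 s, posDev Z s ^ r = 0 := by
  simp [posDev_eq_zero_of_expect_upperVar_le h, Real.zero_rpow hr]

lemma expect_posDev_rpow_le_of_le_two {Z : (Fin n → Bool) → ℝ} {v : ℝ}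
    (hv : 𝔼 s, upperVar Z s ≤ v) {r : ℝ} (h0 : 0 < r) (h2 : r ≤ 2) :
    𝔼 s, posDev Z s ^ r ≤ v ^ (r / 2) :=
  (expect_rpow_le_rpow (posDev_nonneg Z) h0 h2).trans
    (Real.rpow_le_rpow (Finset.expect_nonneg fun s _ => Real.rpow_nonneg (posDev_nonneg Z s) _)
      ((expect_posDev_sq_le Z).trans hv) (by positivity))

/-- Moment bound for the positive part in terms of the moments of the variance proxy. -/
theorem expect_posDev_rpow_le_kappa {Z : (Fin n → Bool) → ℝ} {v q : ℝ} (hv : 0 ≤ v) (hq : 2 ≤ q)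
    (hV : 𝔼 s, upperVar Z s ^ (q / 2) ≤ v ^ (q / 2)) :
    𝔼 s, posDev Z s ^ q ≤ (2 * kappa * q * v) ^ (q / 2) := by
  have hk := half_lt_kappa
  have hVr : ∀ r, 0 < r → r ≤ q → 𝔼 s, upperVar Z s ^ (r / 2) ≤ v ^ (r / 2) := by
    intro r hr hrq
    refine (expect_rpow_le_rpow (upperVar_nonneg Z) (by positivity)
      (show r / 2 ≤ q / 2 by linarith)).trans ?_
    refine (Real.rpow_le_rpow (Finset.expect_nonneg fun s _ =>
      Real.rpow_nonneg (upperVar_nonneg Z s) _) hV (by positivity)).trans_eq ?_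
    rw [← Real.rpow_mul hv, mul_div_cancel₀ _ (by positivity)]
  have hEV : 𝔼 s, upperVar Z s ≤ v := by
    simpa using hVr 2 (by norm_num) hq
  rcases eq_or_lt_of_le hv with rfl | hv
  · rw [expect_posDev_rpow_eq_zero hEV (by linarith)]
    positivity
  -- Induction over unit-length ranges of the real exponent, since the recursion refers to `r - 1`.
  suffices H : ∀ k : ℕ, ∀ r : ℝ, 1 ≤ r → r ≤ q → r ≤ k + 2 →
      𝔼 s, posDev Z s ^ r ≤ (2 * kappa * r * v) ^ (r / 2) by
    obtain ⟨k, hk⟩ := exists_nat_ge q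
    exact H k q (by linarith) le_rfl (by linarith)
  have base : ∀ r : ℝ, 1 ≤ r → r ≤ 2 →
      𝔼 s, posDev Z s ^ r ≤ (2 * kappa * r * v) ^ (r / 2) := by
    intro r h1 h2
    refine (expect_posDev_rpow_le_of_le_two hEV (by linarith) h2).trans ?_
    refine Real.rpow_le_rpow hv.le ?_ (by linarith)
    have : 1 ≤ 2 * kappa * r := by nlinarith
    nlinarith
  intro k
  induction k with
  | zero => intro r h1 _ h2; exact base r h1 (by simpa using h2)
  | succ k ih =>
    intro r h1 hrq hrk
    rcases le_or_gt r 2 with h2 | h2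
    · exact base r h1 h2
    push_cast at hrk
    have hr0 : 0 < r := by linarith
    have hr1 : 0 < r - 1 := by linarith
    have hrec := expect_posDev_rpow_le Z h2.le
    have prev := ih (r - 1) (by linarith) (by linarith) (by linarith)
    set M := 𝔼 s, posDev Z s ^ r with hM
    have hM0 : 0 ≤ M := Finset.expect_nonneg fun s _ => Real.rpow_nonneg (posDev_nonneg Z s) _
    set A := (2 * kappa * r * v) ^ (r / 2) with hA
    have hAbase : 0 < 2 * kappa * r * v := by positivity
    have hApos : 0 < A := Real.rpow_pos_of_pos hAbase _
    have hfirst : (𝔼 s, posDev Z s ^ (r - 1)) ^ (r / (r - 1)) ≤ Real.exp (-(1 / 2)) * A := by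
      refine (Real.rpow_le_rpow (Finset.expect_nonneg fun s _ =>
        Real.rpow_nonneg (posDev_nonneg Z s) _) prev (by positivity)).trans ?_
      rw [← Real.rpow_mul (by positivity)]
      have e : (r - 1) / 2 * (r / (r - 1)) = r / 2 := by field_simp
      have e2 : 2 * kappa * (r - 1) * v = (r - 1) / r * (2 * kappa * r * v) := by field_simp
      rw [e, e2, Real.mul_rpow (by positivity) hAbase.le]
      exact mul_le_mul_of_nonneg_right (one_sub_inv_rpow_le (by linarith)) hApos.le
    -- With these Hölder exponents the factor `posDev Z s ^ (r - 2)` reproduces the moment `M` being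
    -- estimated.
    have hconj : (r / 2).HolderConjugate (r / (r - 2)) := by
      have h3 : 0 < r - 2 := by linarith
      refine Real.holderConjugate_iff.2 ⟨by linarith, ?_⟩
      field_simp
      ring
    have hsecond : 𝔼 s, upperVar Z s * posDev Z s ^ (r - 2) ≤ v * M ^ (1 - 2 / r) := by
      refine (expect_mul_le_rpow_mul_rpow (upperVar_nonneg Z)
        (fun s => Real.rpow_nonneg (posDev_nonneg Z s) _) hconj).trans ?_
      have h3 : r - 2 ≠ 0 := by linarith
      have e : ∀ s, (posDev Z s ^ (r - 2)) ^ (r / (r - 2)) = posDev Z s ^ r := fun s => by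
        rw [← Real.rpow_mul (posDev_nonneg Z s), mul_div_cancel₀ _ h3]
      simp only [e]
      have e2 : 1 / (r / (r - 2)) = 1 - 2 / r := by field_simp
      rw [e2, ← hM]
      refine mul_le_mul_of_nonneg_right ?_ (Real.rpow_nonneg hM0 _)
      refine (Real.rpow_le_rpow (Finset.expect_nonneg fun s _ =>
        Real.rpow_nonneg (upperVar_nonneg Z s) _) (hVr r hr0 hrq) (by positivity)).trans_eq ?_
      rw [← Real.rpow_mul hv.le, mul_one_div_cancel (by positivity), Real.rpow_one]
    -- If `M > A`, then `v < M ^ (2 / r) / (2κr)`, so the second term is at most `(1 - e^(-1/2)) M`.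
    -- With the first at most `e^(-1/2) A`, this forces `M ≤ A`.
    by_contra! hlt
    have hMpos : 0 < M := hApos.trans hlt
    have hM2 : v * M ^ (1 - 2 / r) ≤ M / (2 * kappa * r) := by
      have h3 : 2 * kappa * r * v ≤ M ^ (2 / r) := by
        have := Real.rpow_le_rpow hApos.le hlt.le (show 0 ≤ 2 / r by positivity)
        rwa [hA, ← Real.rpow_mul hAbase.le, div_mul_div_cancel₀ (by norm_num), div_self hr0.ne',
          Real.rpow_one] at this
      rw [Real.rpow_sub hMpos, Real.rpow_one, le_div_iff₀ (by positivity), ← mul_div_assoc,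
        div_mul_eq_mul_div, div_le_iff₀ (by positivity)]
      nlinarith
    have h4 : (r - 1) * 𝔼 s, upperVar Z s * posDev Z s ^ (r - 2) ≤
        M * (1 - Real.exp (-(1 / 2))) := by
      rw [← inv_two_mul_kappa]
      calc _ ≤ r * (M / (2 * kappa * r)) := by
            have := hsecond.trans hM2
            have h5 : 0 ≤ 𝔼 s, upperVar Z s * posDev Z s ^ (r - 2) :=
              Finset.expect_nonneg fun s _ => mul_nonneg (upperVar_nonneg Z s)
                (Real.rpow_nonneg (posDev_nonneg Z s) _)
            nlinarith
        _ = _ := by field_simp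
    have hE := Real.exp_pos (-(1 / 2))
    nlinarith

/-- Moment bound for the positive part under a bounded variance proxy. -/
theorem expect_posDev_rpow_le_bigK {Z : (Fin n → Bool) → ℝ} {c q : ℝ} (hq : 2 ≤ q)
    (hV : ∀ s, upperVar Z s ≤ c) :
    𝔼 s, posDev Z s ^ q ≤ (bigK * q * c) ^ (q / 2) := by
  have hK := bigK_pos
  have hEV : 𝔼 s, upperVar Z s ≤ c :=
    Finset.expect_le Finset.univ_nonempty fun s _ => hV s
  have hc : 0 ≤ c := (upperVar_nonneg Z fun _ => true).trans (hV _)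
  rcases eq_or_lt_of_le hc with rfl | hc
  · rw [expect_posDev_rpow_eq_zero hEV (by linarith)]
    positivity
  have hM0 : ∀ r : ℝ, 0 ≤ 𝔼 s, posDev Z s ^ r := fun r =>
    Finset.expect_nonneg fun s _ => Real.rpow_nonneg (posDev_nonneg Z s) _
  have hrec : ∀ r : ℝ, 2 ≤ r → 𝔼 s, posDev Z s ^ r ≤
      (𝔼 s, posDev Z s ^ (r - 1)) ^ (r / (r - 1)) +
        (r - 1) * (c * 𝔼 s, posDev Z s ^ (r - 2)) := by
    intro r hr
    refine (expect_posDev_rpow_le Z hr).trans (add_le_add_right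
      (mul_le_mul_of_nonneg_left ?_ (by linarith)) _)
    rw [Finset.mul_expect]
    exact Finset.expect_le_expect fun s _ =>
      mul_le_mul_of_nonneg_right (hV s) (Real.rpow_nonneg (posDev_nonneg Z s) _)
  have low : ∀ r : ℝ, 0 < r → r ≤ 2 → 𝔼 s, posDev Z s ^ r ≤ c ^ (r / 2) :=
    fun r => expect_posDev_rpow_le_of_le_two hEV
  have h2 : 𝔼 s, posDev Z s ^ (2 : ℝ) ≤ c := by simpa using low 2 (by norm_num) le_rfl
  have h3 : 𝔼 s, posDev Z s ^ (3 : ℝ) ≤ 3 * c ^ (3 / 2 : ℝ) := by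
    refine (hrec 3 (by norm_num)).trans ?_
    norm_num
    have h1 := low 1 (by norm_num) (by norm_num)
    simp only [Real.rpow_one] at h1
    have h2' := Real.rpow_le_rpow (hM0 2) h2 (show (0 : ℝ) ≤ 3 / 2 by norm_num)
    have e : c * c ^ (1 / 2 : ℝ) = c ^ (3 / 2 : ℝ) := by
      rw [← Real.rpow_one_add' hc.le (by norm_num)]; norm_num
    simp only [Real.rpow_two] at h2'
    nlinarith
  have h4 : 𝔼 s, posDev Z s ^ (4 : ℝ) ≤ 9 * c ^ (2 : ℝ) := by
    refine (hrec 4 (by norm_num)).trans ?_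
    rw [show (4 : ℝ) - 1 = 3 by norm_num, show (4 : ℝ) - 2 = 2 by norm_num]
    have h3' := Real.rpow_le_rpow (hM0 3) h3 (show (0 : ℝ) ≤ 4 / 3 by norm_num)
    rw [Real.mul_rpow (by norm_num) (by positivity), ← Real.rpow_mul hc.le,
      show (3 / 2 * (4 / 3) : ℝ) = 2 by norm_num] at h3'
    -- The recursion at `r = 4` yields `(3 ^ (4/3) + 3) c²`, hence the 9.
    have h6 : (3 : ℝ) ^ (4 / 3 : ℝ) ≤ 6 := by
      rw [← Real.rpow_le_rpow_iff (z := 3) (by positivity) (by norm_num) (by norm_num),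
        ← Real.rpow_mul (by norm_num)]
      norm_num
    rw [Real.rpow_two c] at h3' ⊢
    nlinarith [sq_nonneg c]
  have mid : ∀ r : ℝ, 2 ≤ r → r ≤ 4 → 𝔼 s, posDev Z s ^ r ≤ (bigK * r * c) ^ (r / 2) := by
    intro r hr2 hr4
    -- Pointwise interpolation between exponents 2 and 4 by weighted AM-GM, after normalizing by the
    -- bounds `c` and `9 c²`.
    have hpt : ∀ s, posDev Z s ^ r ≤ 9 ^ ((r - 2) / 2) * c ^ (r / 2) *
        ((4 - r) / 2 * (posDev Z s ^ (2 : ℝ) / c) +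
          (r - 2) / 2 * (posDev Z s ^ (4 : ℝ) / (9 * c ^ (2 : ℝ)))) := by
      intro s
      have hY := posDev_nonneg Z s
      have am := Real.geom_mean_le_arith_mean2_weighted (w₁ := (4 - r) / 2) (w₂ := (r - 2) / 2)
        (p₁ := posDev Z s ^ (2 : ℝ) / c) (p₂ := posDev Z s ^ (4 : ℝ) / (9 * c ^ (2 : ℝ)))
        (by linarith) (by linarith) (by positivity) (by positivity) (by ring)
      refine le_trans (le_of_eq ?_) (mul_le_mul_of_nonneg_left am (by positivity))
      rw [Real.div_rpow (by positivity) hc.le, Real.div_rpow (by positivity) (by positivity),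
        Real.mul_rpow (by norm_num) (by positivity), ← Real.rpow_mul hY, ← Real.rpow_mul hY,
        ← Real.rpow_mul hc.le]
      have e1 : posDev Z s ^ r = posDev Z s ^ (2 * ((4 - r) / 2)) *
          posDev Z s ^ (4 * ((r - 2) / 2)) := by
        rw [← Real.rpow_add_of_nonneg hY (by linarith) (by linarith)]
        congr 1; ring
      have e2 : c ^ (r / 2) = c ^ ((4 - r) / 2) * c ^ (2 * ((r - 2) / 2)) := by
        rw [← Real.rpow_add hc]
        congr 1; ring
      rw [e1, e2]
      field_simp
    refine (Finset.expect_le_expect fun s _ => hpt s).trans ?_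
    rw [← Finset.mul_expect, Finset.expect_add_distrib, ← Finset.mul_expect,
      ← Finset.mul_expect, ← Finset.expect_div, ← Finset.expect_div]
    have a1 : (𝔼 s, posDev Z s ^ (2 : ℝ)) / c ≤ 1 := (div_le_one hc).2 h2
    have a2 : (𝔼 s, posDev Z s ^ (4 : ℝ)) / (9 * c ^ (2 : ℝ)) ≤ 1 :=
      (div_le_one (by positivity)).2 h4
    rw [Real.mul_rpow (by positivity) hc.le]
    have h9 := nine_rpow_le hr2 hr4
    have a3 : (4 - r) / 2 * ((𝔼 s, posDev Z s ^ (2 : ℝ)) / c) +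
        (r - 2) / 2 * ((𝔼 s, posDev Z s ^ (4 : ℝ)) / (9 * c ^ (2 : ℝ))) ≤ 1 := by
      nlinarith
    calc _ ≤ 9 ^ ((r - 2) / 2) * c ^ (r / 2) * 1 := mul_le_mul_of_nonneg_left a3 (by positivity)
      _ ≤ _ := by rw [mul_one]; gcongr
  -- Starting at 4 keeps both `r - 1` and `r - 2` at least 2 and meets the range of
  -- `moment_recursion_constant`.
  suffices H : ∀ k : ℕ, ∀ r : ℝ, 2 ≤ r → r ≤ k + 4 →
      𝔼 s, posDev Z s ^ r ≤ (bigK * r * c) ^ (r / 2) by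
    obtain ⟨k, hk⟩ := exists_nat_ge q
    exact H k q hq (by linarith)
  intro k
  induction k with
  | zero => intro r hr2 hr4; exact mid r hr2 (by simpa using hr4)
  | succ k ih =>
    intro r hr2 hrk
    rcases le_or_gt r 4 with hr4 | hr4
    · exact mid r hr2 hr4
    push_cast at hrk
    have hr1 : 0 < r - 1 := by linarith
    have hr2' : 0 < r - 2 := by linarith
    have p1 := ih (r - 1) (by linarith) (by linarith)
    have p2 := ih (r - 2) (by linarith) (by linarith)
    have hAbase : 0 < bigK * r * c := by positivity
    refine (hrec r hr2).trans ?_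
    have hfirst : (𝔼 s, posDev Z s ^ (r - 1)) ^ (r / (r - 1)) ≤
        ((r - 1) / r) ^ (r / 2) * (bigK * r * c) ^ (r / 2) := by
      refine (Real.rpow_le_rpow (hM0 _) p1 (by positivity)).trans_eq ?_
      rw [← Real.rpow_mul (by positivity), ← Real.mul_rpow (by positivity) hAbase.le]
      congr 1 <;> field_simp
    have hsecond : (r - 1) * (c * 𝔼 s, posDev Z s ^ (r - 2)) ≤
        (1 / bigK) * ((r - 1) / r * ((r - 2) / r) ^ (r / 2 - 1)) *
          (bigK * r * c) ^ (r / 2) := by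
      have e : bigK * (r - 2) * c = (r - 2) / r * (bigK * r * c) := by field_simp
      have e2 : (bigK * r * c) ^ (r / 2) = (bigK * r * c) * (bigK * r * c) ^ (r / 2 - 1) := by
        rw [← Real.rpow_one_add' hAbase.le (by linarith)]; ring_nf
      rw [e, Real.mul_rpow (by positivity) hAbase.le, show (r - 2) / 2 = r / 2 - 1 by ring] at p2
      rw [e2]
      calc _ ≤ (r - 1) * (c * (((r - 2) / r) ^ (r / 2 - 1) * (bigK * r * c) ^ (r / 2 - 1))) := by
            gcongr
        _ = _ := by field_simp
    have g := mul_le_mul_of_nonneg_right (moment_recursion_constant hr4.le)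
      (Real.rpow_nonneg hAbase.le (r / 2))
    rw [one_mul, add_mul] at g
    linarith

end MomentBounds

/-! ### Contraction of coefficient families -/

section Coefficients

variable {n d : ℕ}

/-- Extend a family of coefficients by zero to all finite sets. -/
def extendCoeff (t : Idx n d → ℝ) (S : Finset (Fin n)) : ℝ :=
  if h : S.card = d then t ⟨S, h⟩ else 0

lemma extendCoeff_of_card_ne (t : Idx n d → ℝ) {S : Finset (Fin n)} (h : S.card ≠ d) :
    extendCoeff t S = 0 := dif_neg h

lemma continuous_extendCoeff (S : Finset (Fin n)) :
    Continuous (fun t : Idx n d → ℝ => extendCoeff t S) := by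
  unfold extendCoeff
  split_ifs
  · exact continuous_apply _
  · exact continuous_const

lemma sum_idx_eq (m : ℕ) (f : Finset (Fin n) → ℝ) :
    ∑ J : Idx n m, f J.1 = ∑ J ∈ Finset.powersetCard m Finset.univ, f J :=
  (Finset.sum_subtype _ (fun J => by simp [Finset.mem_powersetCard]) f).symm

lemma chaos_eq_sum (t : Idx n d → ℝ) (x : Fin n → ℝ) :
    chaos t x = ∑ S ∈ Finset.powersetCard d Finset.univ, (∏ i ∈ S, x i) * extendCoeff t S := by
  rw [chaos, ← sum_idx_eq]
  refine Finset.sum_congr rfl fun I _ => ?_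
  rw [extendCoeff, dif_pos I.2]

/-- The cardinality constraint on the tuples is absorbed into the zero extension, leaving a sum over
all tuples that can be split index by index. -/
lemma mixedChaos_eq_sum (k : ℕ) (t : Idx n d → ℝ) (α : Fin k → EuclideanSpace ℝ (Fin n))
    (x : Fin n → ℝ) :
    mixedChaos k t α x = ∑ J ∈ Finset.powersetCard (d - k) Finset.univ, (∏ j ∈ J, x j) *
      ∑ i : Fin k → Fin n, (∏ h, α h (i h)) * extendCoeff t (Finset.univ.image i ∪ J) := by
  rw [mixedChaos, ← sum_idx_eq (n := n) (d - k) (fun J => (∏ j ∈ J, x j) *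
      ∑ i : Fin k → Fin n, (∏ h, α h (i h)) * extendCoeff t (Finset.univ.image i ∪ J))]
  refine Finset.sum_congr rfl fun J _ => ?_
  congr 1
  have h1 : ∀ i : {i : Fin k → Fin n // (Finset.univ.image i ∪ J.1).card = d},
      (∏ h, α h (i.1 h)) * t ⟨Finset.univ.image i.1 ∪ J.1, i.2⟩ =
        (∏ h, α h (i.1 h)) * extendCoeff t (Finset.univ.image i.1 ∪ J.1) := fun i => by
    rw [extendCoeff, dif_pos i.2]
  rw [Finset.sum_congr rfl fun i _ => h1 i]
  rw [← Finset.sum_subtype (Finset.univ.filter fun i : Fin k → Fin n =>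
      (Finset.univ.image i ∪ J.1).card = d) (fun i => by simp)
      (fun i => (∏ h, α h (i h)) * extendCoeff t (Finset.univ.image i ∪ J.1))]
  refine Finset.sum_subset (Finset.filter_subset _ _) fun i _ hi => ?_
  rw [extendCoeff_of_card_ne t (by simpa using hi), mul_zero]

lemma mixedChaos_zero (t : Idx n d → ℝ) (α : Fin 0 → EuclideanSpace ℝ (Fin n))
    (x : Fin n → ℝ) : mixedChaos 0 t α x = chaos t x := by
  rw [mixedChaos_eq_sum, chaos_eq_sum]
  simp

lemma mixedChaos_self (t : Idx n d → ℝ) (α : Fin d → EuclideanSpace ℝ (Fin n))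
    (x y : Fin n → ℝ) : mixedChaos d t α x = mixedChaos d t α y := by
  simp [mixedChaos_eq_sum]

/-- Contract one index of a family of coefficients with a vector. -/
def contract (a : EuclideanSpace ℝ (Fin n)) (t : Idx n (d + 1) → ℝ) : Idx n d → ℝ :=
  fun J => ∑ i, a i * extendCoeff t (insert i J.1)

lemma continuous_contract : Continuous
    (fun p : EuclideanSpace ℝ (Fin n) × (Idx n (d + 1) → ℝ) => contract p.1 p.2) := by
  refine continuous_pi fun J => continuous_finsetSum _ fun i _ => Continuous.mul ?_ ?_
  · fun_prop
  · exact (continuous_extendCoeff _).comp continuous_snd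

/-- For smaller `S` both sides vanish, as `insert i S` is still too small. For larger `S` the
identity can fail, hence the hypothesis. -/
lemma extendCoeff_contract (a : EuclideanSpace ℝ (Fin n)) (t : Idx n (d + 1) → ℝ)
    {S : Finset (Fin n)} (hS : S.card ≤ d) :
    extendCoeff (contract a t) S = ∑ i, a i * extendCoeff t (insert i S) := by
  rcases hS.eq_or_lt with h | h
  · rw [extendCoeff, dif_pos h, contract]
  · rw [extendCoeff_of_card_ne _ h.ne]
    refine (Finset.sum_eq_zero fun i _ => ?_).symm
    rw [extendCoeff_of_card_ne, mul_zero]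
    have := Finset.card_insert_le i S
    omega

lemma image_cons (k : ℕ) (i₀ : Fin n) (i : Fin k → Fin n) :
    Finset.univ.image (Fin.cons i₀ i : Fin (k + 1) → Fin n) =
      insert i₀ (Finset.univ.image i) := by
  ext j
  simp [Fin.exists_fin_succ, eq_comm]

lemma mixedChaos_cons {k : ℕ} (hk : k ≤ d) (t : Idx n (d + 1) → ℝ)
    (a : EuclideanSpace ℝ (Fin n)) (α : Fin k → EuclideanSpace ℝ (Fin n)) (x : Fin n → ℝ) :
    mixedChaos (k + 1) t (Fin.cons a α : Fin (k + 1) → EuclideanSpace ℝ (Fin n)) x =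
      mixedChaos k (contract a t) α x := by
  rw [mixedChaos_eq_sum, mixedChaos_eq_sum, Nat.add_sub_add_right]
  refine Finset.sum_congr rfl fun J hJ => ?_
  congr 1
  rw [← (Fin.consEquiv (fun _ : Fin (k + 1) => Fin n)).sum_comp, Fintype.sum_prod_type_right]
  refine Finset.sum_congr rfl fun i _ => ?_
  have hcard : (Finset.univ.image i ∪ J).card ≤ d := by
    have h1 := Finset.card_union_le (Finset.univ.image i) J
    have h2 : (Finset.univ.image i).card ≤ k := by
      simpa using Finset.card_image_le (s := Finset.univ) (f := i)
    rw [(Finset.mem_powersetCard.1 hJ).2] at h1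
    omega
  rw [extendCoeff_contract a t hcard, Finset.mul_sum]
  refine Finset.sum_congr rfl fun i₀ _ => ?_
  simp only [Fin.consEquiv, Equiv.coe_fn_mk, Fin.prod_univ_succ, Fin.cons_zero, Fin.cons_succ,
    image_cons, Finset.insert_union]
  ring

end Coefficients

/-! ### Suprema and reduction of the order -/

section Suprema

variable {n d : ℕ}

/-- The contractions of the elements of `T` with the vectors of the Euclidean unit ball. -/
def contractSet (T : Set (Idx n (d + 1) → ℝ)) : Set (Idx n d → ℝ) :=
  (fun p : EuclideanSpace ℝ (Fin n) × (Idx n (d + 1) → ℝ) => contract p.1 p.2) ''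
    (Metric.closedBall 0 1 ×ˢ T)

lemma isCompact_contractSet {T : Set (Idx n (d + 1) → ℝ)} (hT : IsCompact T) :
    IsCompact (contractSet T) :=
  ((isCompact_closedBall _ _).prod hT).image continuous_contract

lemma contractSet_nonempty {T : Set (Idx n (d + 1) → ℝ)} (hT : T.Nonempty) :
    (contractSet T).Nonempty :=
  ((Metric.nonempty_closedBall.2 zero_le_one).prod hT).image _

/-- Contracting with `α 0` absorbs one decoupled vector into the coefficients; this drives the
induction on the order. -/
lemma supMixed_succ (T : Set (Idx n (d + 1) → ℝ)) {k : ℕ} (hk : k ≤ d) (x : Fin n → ℝ) :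
    supMixed T (k + 1) x = supMixed (contractSet T) k x := by
  unfold supMixed
  congr 1
  ext r
  constructor
  · rintro ⟨t, ht, α, hα, rfl⟩
    refine ⟨contract (α 0) t, ⟨(α 0, t), ⟨by simpa using hα 0, ht⟩, rfl⟩,
      fun h => α h.succ, fun h => hα _, ?_⟩
    rw [← mixedChaos_cons hk]
    congr 2
    exact (Fin.cons_self_tail α).symm
  · rintro ⟨_, ⟨⟨a, t⟩, ⟨ha, ht⟩, rfl⟩, α, hα, rfl⟩
    refine ⟨t, ht, Fin.cons a α, fun h => ?_, ?_⟩
    · induction h using Fin.cases with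
      | zero => simpa using ha
      | succ h => simpa using hα h
    · rw [mixedChaos_cons hk]

lemma supMixed_zero (T : Set (Idx n d → ℝ)) (x : Fin n → ℝ) :
    supMixed T 0 x = supChaos T x := by
  unfold supMixed supChaos
  congr 1
  ext r
  constructor
  · rintro ⟨t, ht, α, -, rfl⟩
    exact ⟨t, ht, by rw [mixedChaos_zero]⟩
  · rintro ⟨t, ht, rfl⟩
    exact ⟨t, ht, fun _ => 0, by simp, by rw [mixedChaos_zero]⟩

lemma supMixed_one (T : Set (Idx n (d + 1) → ℝ)) (x : Fin n → ℝ) :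
    supMixed T 1 x = supChaos (contractSet T) x := by
  rw [← supMixed_zero, ← supMixed_succ T d.zero_le]

lemma supMixed_self (T : Set (Idx n d → ℝ)) (x y : Fin n → ℝ) :
    supMixed T d x = supMixed T d y := by
  unfold supMixed
  simp only [mixedChaos_self _ _ x y]

lemma supMixed_nonneg (T : Set (Idx n d → ℝ)) (k : ℕ) (x : Fin n → ℝ) :
    0 ≤ supMixed T k x :=
  Real.sSup_nonneg (by rintro _ ⟨t, -, α, -, rfl⟩; exact abs_nonneg _)

lemma continuous_abs_chaos (x : Fin n → ℝ) :
    Continuous (fun t : Idx n d → ℝ => |chaos t x|) := by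
  unfold chaos
  fun_prop

lemma abs_chaos_le_supChaos {T : Set (Idx n d → ℝ)} (hT : IsCompact T) {t : Idx n d → ℝ}
    (ht : t ∈ T) (x : Fin n → ℝ) : |chaos t x| ≤ supChaos T x := by
  refine le_csSup ?_ ⟨t, ht, rfl⟩
  refine (hT.bddAbove_image (continuous_abs_chaos x).continuousOn).mono ?_
  rintro _ ⟨t, ht, rfl⟩
  exact ⟨t, ht, rfl⟩

lemma exists_supChaos_le {T : Set (Idx n d → ℝ)} (hT : IsCompact T) (hTne : T.Nonempty)
    (x : Fin n → ℝ) : ∃ t ∈ T, supChaos T x ≤ |chaos t x| := by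
  obtain ⟨t, ht, hmax⟩ := hT.exists_isMaxOn hTne (continuous_abs_chaos x).continuousOn
  refine ⟨t, ht, csSup_le ⟨_, t, ht, rfl⟩ ?_⟩
  rintro _ ⟨u, hu, rfl⟩
  exact hmax hu

end Suprema

/-! ### Discrete gradient of the chaos -/

section Gradient

variable {n d : ℕ}

/-- The partial derivative of the chaos in the `i`-th variable. -/
def chaosDeriv (t : Idx n (d + 1) → ℝ) (x : Fin n → ℝ) (i : Fin n) : ℝ :=
  ∑ J ∈ Finset.powersetCard d Finset.univ, (∏ j ∈ J, x j) * extendCoeff t (insert i J)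

lemma chaos_contract (a : EuclideanSpace ℝ (Fin n)) (t : Idx n (d + 1) → ℝ) (x : Fin n → ℝ) :
    chaos (contract a t) x = ∑ i, a i * chaosDeriv t x i := by
  simp only [chaos_eq_sum, chaosDeriv, Finset.mul_sum]
  rw [Finset.sum_comm]
  refine Finset.sum_congr rfl fun J hJ => ?_
  rw [extendCoeff_contract a t (Finset.mem_powersetCard.1 hJ).2.le, Finset.mul_sum]
  exact Finset.sum_congr rfl fun i _ => by ring

/-- Sets `J` containing `i` drop out: `insert i J = J` has the wrong size. Hence the derivative does
not depend on `x i`. -/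
lemma chaosDeriv_eq_sum_erase (t : Idx n (d + 1) → ℝ) (x : Fin n → ℝ) (i : Fin n) :
    chaosDeriv t x i = ∑ J ∈ Finset.powersetCard d (Finset.univ.erase i),
      (∏ j ∈ J, x j) * extendCoeff t (insert i J) := by
  refine (Finset.sum_subset (Finset.powersetCard_mono (Finset.erase_subset _ _))
    fun J hJ hJ' => ?_).symm
  have hcard := (Finset.mem_powersetCard.1 hJ).2
  have hi : i ∈ J := by
    by_contra hi
    exact hJ' (Finset.mem_powersetCard.2 ⟨fun j hj => Finset.mem_erase.2
      ⟨fun h => hi (h ▸ hj), Finset.mem_univ _⟩, hcard⟩)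
  rw [Finset.insert_eq_of_mem hi, extendCoeff_of_card_ne t (by omega), mul_zero]

lemma chaos_eq_add_mul_chaosDeriv (t : Idx n (d + 1) → ℝ) (x : Fin n → ℝ) (i : Fin n) :
    chaos t x = ∑ S ∈ Finset.powersetCard (d + 1) (Finset.univ.erase i),
      (∏ j ∈ S, x j) * extendCoeff t S + x i * chaosDeriv t x i := by
  have hi : i ∉ Finset.univ.erase i := Finset.notMem_erase i _
  have hnot : ∀ {m : ℕ} {S : Finset (Fin n)},
      S ∈ Finset.powersetCard m (Finset.univ.erase i) → i ∉ S := fun hS h =>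
    hi ((Finset.mem_powersetCard.1 hS).1 h)
  rw [chaos_eq_sum, ← Finset.insert_erase (Finset.mem_univ i),
    Finset.powersetCard_succ_insert hi, Finset.insert_erase (Finset.mem_univ i),
    Finset.sum_union, Finset.sum_image, chaosDeriv_eq_sum_erase, Finset.mul_sum]
  · congr 1
    refine Finset.sum_congr rfl fun J hJ => ?_
    rw [Finset.prod_insert (hnot hJ), mul_assoc]
  · intro J hJ J' hJ' h
    rw [← Finset.erase_insert (hnot hJ), ← Finset.erase_insert (hnot hJ'), h]
  · rw [Finset.disjoint_left]
    intro S hS hS'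
    obtain ⟨J, -, rfl⟩ := Finset.mem_image.1 hS'
    exact hnot hS (Finset.mem_insert_self _ _)

lemma chaosDeriv_congr (t : Idx n (d + 1) → ℝ) {x y : Fin n → ℝ} {i : Fin n}
    (h : ∀ j, j ≠ i → x j = y j) : chaosDeriv t x i = chaosDeriv t y i := by
  rw [chaosDeriv_eq_sum_erase, chaosDeriv_eq_sum_erase]
  refine Finset.sum_congr rfl fun J hJ => ?_
  congr 1
  exact Finset.prod_congr rfl fun j hj =>
    h j (Finset.ne_of_mem_erase ((Finset.mem_powersetCard.1 hJ).1 hj))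

lemma chaos_sub_chaos (t : Idx n (d + 1) → ℝ) {x y : Fin n → ℝ} {i : Fin n}
    (h : ∀ j, j ≠ i → x j = y j) :
    chaos t x - chaos t y = (x i - y i) * chaosDeriv t x i := by
  rw [chaos_eq_add_mul_chaosDeriv t x i, chaos_eq_add_mul_chaosDeriv t y i,
    chaosDeriv_congr t h]
  have : ∑ S ∈ Finset.powersetCard (d + 1) (Finset.univ.erase i),
      (∏ j ∈ S, x j) * extendCoeff t S = ∑ S ∈ Finset.powersetCard (d + 1) (Finset.univ.erase i),
      (∏ j ∈ S, y j) * extendCoeff t S := by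
    refine Finset.sum_congr rfl fun J hJ => ?_
    congr 1
    exact Finset.prod_congr rfl fun j hj =>
      h j (Finset.ne_of_mem_erase ((Finset.mem_powersetCard.1 hJ).1 hj))
  rw [this]
  ring

/-- The Euclidean norm of the gradient is bounded by the first mixed supremum. -/
lemma sum_chaosDeriv_sq_le {T : Set (Idx n (d + 1) → ℝ)} (hT : IsCompact T)
    {t : Idx n (d + 1) → ℝ} (ht : t ∈ T) (x : Fin n → ℝ) :
    ∑ i, chaosDeriv t x i ^ 2 ≤ supMixed T 1 x ^ 2 := by
  set b : EuclideanSpace ℝ (Fin n) := WithLp.toLp 2 (chaosDeriv t x) with hb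
  have hnorm : ‖b‖ ^ 2 = ∑ i, chaosDeriv t x i ^ 2 := by
    rw [EuclideanSpace.real_norm_sq_eq]
  -- The normalized gradient attains the dual norm. If `b = 0` the inverse is 0 and the vector still
  -- lies in the ball.
  have hmem : contract (‖b‖⁻¹ • b) t ∈ contractSet T := by
    refine ⟨(‖b‖⁻¹ • b, t), ⟨?_, ht⟩, rfl⟩
    rw [mem_closedBall_zero_iff, norm_smul, norm_inv, norm_norm]
    exact inv_mul_le_one
  have hval : chaos (contract (‖b‖⁻¹ • b) t) x = ‖b‖ := by
    rw [chaos_contract]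
    have : ∀ i, (‖b‖⁻¹ • b) i * chaosDeriv t x i = ‖b‖⁻¹ * chaosDeriv t x i ^ 2 := fun i => by
      simp [hb]; ring
    simp only [this]
    rw [← Finset.mul_sum, ← hnorm]
    rcases eq_or_ne ‖b‖ 0 with h | h
    · simp [h]
    · field_simp
  have := abs_chaos_le_supChaos (isCompact_contractSet hT) hmem x
  rw [hval, abs_norm, ← supMixed_one] at this
  rw [← hnorm]
  gcongr

end Gradient

/-! ### Variance proxy of a supremum of chaoses -/

section Signs

variable {n d : ℕ}

/-- The vector of signs attached to a point of the discrete cube. -/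
def signs (s : Fin n → Bool) (i : Fin n) : ℝ := if s i then 1 else -1

lemma signs_flip_of_ne {i j : Fin n} (h : j ≠ i) (s : Fin n → Bool) :
    signs s j = signs (flip i s) j := by
  simp [signs, flip, h]

lemma abs_signs_sub_signs_flip (i : Fin n) (s : Fin n → Bool) :
    |signs s i - signs (flip i s) i| = 2 := by
  cases h : s i <;> simp [signs, flip, h] <;> norm_num

/-- Only decreases of `Z` count, so a single maximizer at `s` serves for every flip. Each decrease
is at most twice a partial derivative, and `4 / 2` gives the factor 2. -/
lemma upperVar_supChaos_le {T : Set (Idx n (d + 1) → ℝ)} (hT : IsCompact T) (hTne : T.Nonempty)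
    (s : Fin n → Bool) :
    upperVar (fun s => supChaos T (signs s)) s ≤ 2 * supMixed T 1 (signs s) ^ 2 := by
  obtain ⟨t, ht, hmax⟩ := exists_supChaos_le hT hTne (signs s)
  have hi : ∀ i, max (supChaos T (signs s) - supChaos T (signs (flip i s))) 0 ^ 2 ≤
      4 * chaosDeriv t (signs s) i ^ 2 := by
    intro i
    have h1 := abs_chaos_le_supChaos hT ht (signs (flip i s))
    have h2 : |chaos t (signs s) - chaos t (signs (flip i s))| =
        2 * |chaosDeriv t (signs s) i| := by
      rw [chaos_sub_chaos t fun j hj => signs_flip_of_ne hj s, abs_mul, abs_signs_sub_signs_flip]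
    have h3 := abs_sub_abs_le_abs_sub (chaos t (signs s)) (chaos t (signs (flip i s)))
    have h4 : max (supChaos T (signs s) - supChaos T (signs (flip i s))) 0 ≤
        2 * |chaosDeriv t (signs s) i| := max_le (by linarith) (by positivity)
    have h5 := pow_le_pow_left₀ (le_max_right _ _) h4 2
    rw [mul_pow, sq_abs] at h5
    linarith
  have h := Finset.sum_le_sum fun i (_ : i ∈ Finset.univ) => hi i
  rw [← Finset.mul_sum] at h
  have h' := sum_chaosDeriv_sq_le hT ht (signs s)
  rw [upperVar]
  linarith

end Signs

/-! ### Induction on the order -/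

section CubeBound

variable {n d : ℕ}

/-- Minkowski applied to `W ≤ 𝔼 W + (W - 𝔼 W)₊`. -/
lemma rpow_expect_le_expect_add (W : (Fin n → Bool) → ℝ) (hW : ∀ s, 0 ≤ W s) {q : ℝ}
    (hq : 1 ≤ q) :
    (𝔼 s, W s ^ q) ^ (1 / q) ≤ 𝔼 s, W s + (𝔼 s, posDev W s ^ q) ^ (1 / q) := by
  have hE : 0 ≤ 𝔼 s, W s := Finset.expect_nonneg fun s _ => hW s
  have h := rpow_expect_add_le (f := fun _ : Fin n → Bool => 𝔼 u, W u) (g := posDev W)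
    (fun _ => hE) (posDev_nonneg W) hq
  rw [Fintype.expect_const, ← Real.rpow_mul hE, mul_one_div_cancel (by linarith),
    Real.rpow_one] at h
  refine le_trans (Real.rpow_le_rpow (Finset.expect_nonneg fun s _ => Real.rpow_nonneg (hW s) _)
    (Finset.expect_le_expect fun s _ => Real.rpow_le_rpow (hW s) ?_ (by linarith))
    (by positivity)) h
  have := le_max_left (W s - 𝔼 u, W u) 0
  rw [posDev]
  linarith

/-- One step of the iteration: `‖(Z - EZ)₊‖_q ≤ √(4κq) ‖W‖_q` if `V₊ ≤ 2W²`. -/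
lemma rpow_expect_posDev_le_kappa {Z W : (Fin n → Bool) → ℝ} (hW : ∀ s, 0 ≤ W s)
    (hV : ∀ s, upperVar Z s ≤ 2 * W s ^ 2) {q : ℝ} (hq : 2 ≤ q) :
    (𝔼 s, posDev Z s ^ q) ^ (1 / q) ≤
      (4 * kappa * q) ^ (1 / 2 : ℝ) * (𝔼 s, W s ^ q) ^ (1 / q) := by
  have hk := kappa_pos
  have hq0 : 0 < q := by linarith
  set N := (𝔼 s, W s ^ q) ^ (1 / q) with hN
  have hWq : 0 ≤ 𝔼 s, W s ^ q := Finset.expect_nonneg fun s _ => Real.rpow_nonneg (hW s) _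
  have hN0 : 0 ≤ N := Real.rpow_nonneg hWq _
  have e : ∀ w : ℝ, 0 ≤ w → (2 * w ^ 2) ^ (q / 2) = 2 ^ (q / 2) * w ^ q := fun w hw => by
    rw [Real.mul_rpow (by norm_num) (by positivity), ← Real.rpow_two, ← Real.rpow_mul hw,
      mul_div_cancel₀ _ (by norm_num)]
  have hNq : N ^ q = 𝔼 s, W s ^ q := by
    rw [hN, ← Real.rpow_mul hWq, one_div_mul_cancel hq0.ne', Real.rpow_one]
  have h := expect_posDev_rpow_le_kappa (Z := Z) (v := 2 * N ^ 2) (by positivity) hq (by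
    rw [e N hN0, hNq, Finset.mul_expect]
    refine Finset.expect_le_expect fun s _ => ?_
    rw [← e _ (hW s)]
    exact Real.rpow_le_rpow (upperVar_nonneg Z s) (hV s) (by positivity))
  refine (Real.rpow_le_rpow (Finset.expect_nonneg fun s _ =>
    Real.rpow_nonneg (posDev_nonneg Z s) _) h (by positivity)).trans_eq ?_
  have hb : 0 ≤ 2 * kappa * q * (2 * N ^ 2) := by positivity
  rw [← Real.rpow_mul hb, show q / 2 * (1 / q) = 1 / 2 by field_simp,
    show 2 * kappa * q * (2 * N ^ 2) = 4 * kappa * q * N ^ 2 by ring,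
    Real.mul_rpow (by positivity) (by positivity), ← Real.sqrt_eq_rpow (N ^ 2),
    Real.sqrt_sq hN0]

lemma rpow_expect_posDev_le_bigK {Z : (Fin n → Bool) → ℝ} {w : ℝ} (hw : 0 ≤ w)
    (hV : ∀ s, upperVar Z s ≤ 2 * w ^ 2) {q : ℝ} (hq : 2 ≤ q) :
    (𝔼 s, posDev Z s ^ q) ^ (1 / q) ≤ √(2 * bigK) * q ^ (1 / 2 : ℝ) * w := by
  have hK := bigK_pos
  have hq0 : 0 < q := by linarith
  refine (Real.rpow_le_rpow (Finset.expect_nonneg fun s _ =>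
    Real.rpow_nonneg (posDev_nonneg Z s) _) (expect_posDev_rpow_le_bigK hq hV)
    (by positivity)).trans_eq ?_
  have hb : 0 ≤ bigK * q * (2 * w ^ 2) := by positivity
  rw [← Real.rpow_mul hb, show q / 2 * (1 / q) = 1 / 2 by field_simp,
    show bigK * q * (2 * w ^ 2) = 2 * bigK * q * w ^ 2 by ring,
    Real.mul_rpow (by positivity) (by positivity), Real.mul_rpow (by positivity) hq0.le,
    ← Real.sqrt_eq_rpow (w ^ 2), Real.sqrt_sq hw, ← Real.sqrt_eq_rpow (2 * bigK)]

/-- The moment inequality for suprema of Rademacher chaoses, on the discrete cube. -/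
theorem rpow_expect_posDev_supChaos_le (n : ℕ) {q : ℝ} (hq : 2 ≤ q) :
    ∀ (d : ℕ) (T : Set (Idx n (d + 1) → ℝ)), IsCompact T → T.Nonempty → ∀ x : Fin n → ℝ,
      (𝔼 s, posDev (fun s => supChaos T (signs s)) s ^ q) ^ (1 / q) ≤
        ∑ j ∈ Finset.range d, (4 * kappa * q) ^ (((j + 1 : ℕ) : ℝ) / 2) *
            𝔼 s, supMixed T (j + 1) (signs s) +
          (4 * kappa) ^ ((d : ℝ) / 2) * √(2 * bigK) * q ^ (((d + 1 : ℕ) : ℝ) / 2) *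
            supMixed T (d + 1) x := by
  have hk := kappa_pos
  have hq0 : 0 < q := by linarith
  intro d
  induction d with
  | zero =>
    intro T hT hTne x
    -- At order one `W₁` is free of signs, so the bounded-variance estimate with the better constant
    -- applies.
    have h := rpow_expect_posDev_le_bigK (Z := fun s => supChaos T (signs s))
      (supMixed_nonneg T 1 x) (fun s => by
        rw [supMixed_self T x (signs s)]
        exact upperVar_supChaos_le hT hTne s) hq
    simpa using h
  | succ d ih =>
    intro T hT hTne x
    have h1 := rpow_expect_posDev_le_kappa (W := fun s => supMixed T 1 (signs s))
      (fun s => supMixed_nonneg _ _ _) (upperVar_supChaos_le hT hTne) hq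
    have h2 := rpow_expect_le_expect_add (fun s : Fin n → Bool => supMixed T 1 (signs s))
      (fun s => supMixed_nonneg _ _ _) (show 1 ≤ q by linarith)
    -- The induction hypothesis controls the upper deviation of `W₁`, a supremum of chaoses of lower
    -- order.
    have h3 := ih (contractSet T) (isCompact_contractSet hT) (contractSet_nonempty hTne) x
    simp only [← supMixed_one] at h3
    rw [← supMixed_succ T le_rfl x, Finset.sum_congr rfl (g := fun j =>
      (4 * kappa * q) ^ (((j + 1 : ℕ) : ℝ) / 2) *
        𝔼 s : Fin n → Bool, supMixed T (j + 1 + 1) (signs s)) (fun j hj => by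
        simp only [supMixed_succ T (show j + 1 ≤ d + 1 by
          have := Finset.mem_range.1 hj; omega)])] at h3
    refine (h1.trans (mul_le_mul_of_nonneg_left (h2.trans (add_le_add_right h3 _))
      (by positivity))).trans_eq ?_
    have hA : 0 < 4 * kappa * q := by positivity
    have e1 : ∀ j : ℕ, (4 * kappa * q) ^ (((j + 1 + 1 : ℕ) : ℝ) / 2) =
        (4 * kappa * q) ^ (1 / 2 : ℝ) * (4 * kappa * q) ^ (((j + 1 : ℕ) : ℝ) / 2) := fun j => by
      rw [← Real.rpow_add hA]; congr 1; push_cast; ring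
    have e2 : (4 * kappa) ^ (((d + 1 : ℕ) : ℝ) / 2) * q ^ (((d + 1 + 1 : ℕ) : ℝ) / 2) =
        (4 * kappa * q) ^ (1 / 2 : ℝ) *
          ((4 * kappa) ^ ((d : ℝ) / 2) * q ^ (((d + 1 : ℕ) : ℝ) / 2)) := by
      rw [Real.mul_rpow (by positivity) hq0.le]
      have a1 : (4 * kappa) ^ (((d + 1 : ℕ) : ℝ) / 2) =
          (4 * kappa) ^ (1 / 2 : ℝ) * (4 * kappa) ^ ((d : ℝ) / 2) := by
        rw [← Real.rpow_add (by positivity)]; congr 1; push_cast; ring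
      have a2 : q ^ (((d + 1 + 1 : ℕ) : ℝ) / 2) =
          q ^ (1 / 2 : ℝ) * q ^ (((d + 1 : ℕ) : ℝ) / 2) := by
        rw [← Real.rpow_add hq0]; congr 1; push_cast; ring
      rw [a1, a2]; ring
    have e3 : (4 * kappa) ^ (((d + 1 : ℕ) : ℝ) / 2) * √(2 * bigK) *
        q ^ (((d + 1 + 1 : ℕ) : ℝ) / 2) = (4 * kappa * q) ^ (1 / 2 : ℝ) *
          ((4 * kappa) ^ ((d : ℝ) / 2) * √(2 * bigK) * q ^ (((d + 1 : ℕ) : ℝ) / 2)) := by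
      linear_combination √(2 * bigK) * e2
    have e4 : ∑ j ∈ Finset.range d, (4 * kappa * q) ^ (((j + 1 + 1 : ℕ) : ℝ) / 2) *
        𝔼 s : Fin n → Bool, supMixed T (j + 1 + 1) (signs s) =
        (4 * kappa * q) ^ (1 / 2 : ℝ) * ∑ j ∈ Finset.range d,
          (4 * kappa * q) ^ (((j + 1 : ℕ) : ℝ) / 2) *
            𝔼 s : Fin n → Bool, supMixed T (j + 1 + 1) (signs s) := by
      rw [Finset.mul_sum]
      exact Finset.sum_congr rfl fun j _ => by rw [e1, mul_assoc]
    rw [Finset.sum_range_succ', e3, e4, zero_add, Nat.cast_one]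
    ring

end CubeBound

/-! ### From the cube to the probability space -/

section Transfer

variable {Ω : Type*} [MeasurableSpace Ω] {μ : Measure Ω} {n : ℕ}
  {X : Fin n → Ω → ℝ}

/-- The event that the variables take prescribed signs. -/
def signEvent (X : Fin n → Ω → ℝ) (s : Fin n → Bool) : Set Ω :=
  ⋂ i ∈ (Finset.univ : Finset (Fin n)), X i ⁻¹' {signs s i}

lemma measurableSet_signEvent (hX : ∀ i, IsRademacher μ (X i)) (s : Fin n → Bool) :
    MeasurableSet (signEvent X s) :=
  Finset.measurableSet_biInter _ fun i _ => (hX i).1 (measurableSet_singleton _)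

lemma measure_signEvent (hX : ∀ i, IsRademacher μ (X i)) (hindep : iIndepFun X μ)
    (s : Fin n → Bool) : μ (signEvent X s) = (1 / 2) ^ n := by
  rw [signEvent, hindep.measure_inter_preimage_eq_mul Finset.univ
    (fun i _ => measurableSet_singleton _)]
  have : ∀ i, μ (X i ⁻¹' {signs s i}) = 1 / 2 := fun i => by
    cases h : s i
    · simpa [signs, h, Set.preimage] using (hX i).2.2
    · simpa [signs, h, Set.preimage] using (hX i).2.1
  simp [this]

variable [IsProbabilityMeasure μ]

lemma ae_eq_one_or_neg_one (hX : ∀ i, IsRademacher μ (X i)) :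
    ∀ᵐ ω ∂μ, ∀ i, X i ω = 1 ∨ X i ω = -1 := by
  rw [ae_all_iff]
  intro i
  have m1 : MeasurableSet {ω | X i ω = 1} := (hX i).1 (measurableSet_singleton 1)
  have m2 : MeasurableSet {ω | X i ω = -1} := (hX i).1 (measurableSet_singleton (-1))
  have hd : Disjoint {ω | X i ω = 1} {ω | X i ω = -1} := by
    rw [Set.disjoint_left]
    intro ω h1 h2
    simp only [Set.mem_ofPred_eq] at h1 h2
    linarith
  have h := measure_union (μ := μ) hd m2
  rw [(hX i).2.1, (hX i).2.2, ENNReal.add_halves] at h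
  exact (mem_ae_iff_prob_eq_one (m1.union m2)).2 h

/-- Almost surely the variables form a sign vector, so the composition is a.e. a simple function;
`F` needs no measurability. -/
lemma comp_ae_eq_sum_indicator (hX : ∀ i, IsRademacher μ (X i)) (F : (Fin n → ℝ) → ℝ) :
    (fun ω => F (fun i => X i ω)) =ᵐ[μ]
      fun ω => ∑ s : Fin n → Bool, (signEvent X s).indicator (fun _ => F (signs s)) ω := by
  filter_upwards [ae_eq_one_or_neg_one hX] with ω hω
  have hs : (fun i => X i ω) = signs (fun i => decide (X i ω = 1)) := by
    ext i
    rcases hω i with h | h <;> norm_num [signs, h]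
  rw [Finset.sum_eq_single (fun i => decide (X i ω = 1))]
  · rw [Set.indicator_of_mem, ← hs]
    simp only [signEvent, Set.mem_iInter]
    exact fun i _ => congrFun hs i
  · intro s _ hne
    refine Set.indicator_of_notMem (fun hmem => hne ?_) _
    ext i
    simp only [signEvent, Set.mem_iInter] at hmem
    have h : X i ω = signs s i := hmem i (Finset.mem_univ i)
    cases hi : s i <;> simp [h, signs, hi]; norm_num
  · intro h; exact absurd (Finset.mem_univ _) h

lemma memLp_comp (hX : ∀ i, IsRademacher μ (X i)) (F : (Fin n → ℝ) → ℝ) (p : ENNReal) :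
    MemLp (fun ω => F (fun i => X i ω)) p μ := by
  refine (memLp_congr_ae (comp_ae_eq_sum_indicator hX F)).2 ?_
  exact memLp_finsetSum _ fun s _ =>
    memLp_indicator_const p (measurableSet_signEvent hX s) _ (Or.inr (measure_ne_top _ _))

lemma integral_comp (hX : ∀ i, IsRademacher μ (X i)) (hindep : iIndepFun X μ)
    (F : (Fin n → ℝ) → ℝ) :
    ∫ ω, F (fun i => X i ω) ∂μ = 𝔼 s, F (signs s) := by
  rw [integral_congr_ae (comp_ae_eq_sum_indicator hX F), integral_finsetSum]
  · rw [Fintype.expect_eq_sum_div_card, Finset.sum_div]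
    refine Finset.sum_congr rfl fun s _ => ?_
    rw [integral_indicator_const _ (measurableSet_signEvent hX s), measureReal_def,
      measure_signEvent hX hindep]
    simp [div_eq_inv_mul]
  · intro s _
    exact (integrable_const _).indicator (measurableSet_signEvent hX s)

end Transfer

/-- Gives the second inequality of the theorem: the sharper last step is compared with the generic
one through `2K ≤ 4κ`. -/
lemma rpow_mul_sqrt_bigK_le (d : ℕ) {q : ℝ} (hq : 0 ≤ q) :
    (4 * kappa) ^ ((d : ℝ) / 2) * √(2 * bigK) * q ^ (((d + 1 : ℕ) : ℝ) / 2) ≤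
      (4 * kappa * q) ^ (((d + 1 : ℕ) : ℝ) / 2) := by
  have hk := kappa_pos
  rw [Real.mul_rpow (by positivity) hq]
  refine mul_le_mul_of_nonneg_right ?_ (Real.rpow_nonneg hq _)
  have e : (4 * kappa) ^ (((d + 1 : ℕ) : ℝ) / 2) = (4 * kappa) ^ ((d : ℝ) / 2) * √(4 * kappa) := by
    rw [Real.sqrt_eq_rpow, ← Real.rpow_add (by positivity)]; congr 1; push_cast; ring
  rw [e]
  refine mul_le_mul_of_nonneg_left (Real.sqrt_le_sqrt ?_) (by positivity)
  linarith [bigK_le_two_mul_kappa]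

lemma sum_Icc_one_eq_sum_range (d : ℕ) (f : ℕ → ℝ) :
    ∑ j ∈ Finset.Icc 1 d, f j = ∑ j ∈ Finset.range d, f (j + 1) := by
  rw [Finset.range_eq_Ico, Finset.sum_Ico_add' f 0 d 1]
  rfl

end RademacherChaos

theorem theorem14 {Ω : Type*} [MeasurableSpace Ω] (μ : Measure Ω) [IsProbabilityMeasure μ]
    (n d : ℕ) (hd : 1 ≤ d)
    (X : Fin n → Ω → ℝ) (hX : ∀ i, RademacherChaos.IsRademacher μ (X i))
    (hindep : iIndepFun X μ)
    (T : Set (RademacherChaos.Idx n d → ℝ)) (hT : IsCompact T) (hTne : T.Nonempty)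
    (Z : Ω → ℝ) (hZ : ∀ ω, Z ω = RademacherChaos.supChaos T (fun i => X i ω))
    (W : ℕ → Ω → ℝ) (hW : ∀ k ω, W k ω = RademacherChaos.supMixed T k (fun i => X i ω))
    (q : ℝ) (hq : 2 ≤ q) :
    Integrable Z μ ∧
    (∀ j ∈ Finset.Icc 1 d, Integrable (W j) μ) ∧
    MemLp (fun ω => max (Z ω - ∫ ω', Z ω' ∂μ) 0) (ENNReal.ofReal q) μ ∧
    ∀ ω₀ : Ω,
      RademacherChaos.lqNorm μ q (fun ω => max (Z ω - ∫ ω', Z ω' ∂μ) 0) ≤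
        (∑ j ∈ Finset.Icc 1 (d - 1),
            (4 * RademacherChaos.kappa * q) ^ ((j : ℝ) / 2) * (∫ ω, W j ω ∂μ))
          + (4 * RademacherChaos.kappa) ^ (((d : ℝ) - 1) / 2) * √(2 * RademacherChaos.bigK)
            * q ^ ((d : ℝ) / 2) * W d ω₀ ∧
      (∑ j ∈ Finset.Icc 1 (d - 1),
            (4 * RademacherChaos.kappa * q) ^ ((j : ℝ) / 2) * (∫ ω, W j ω ∂μ))
          + (4 * RademacherChaos.kappa) ^ (((d : ℝ) - 1) / 2) * √(2 * RademacherChaos.bigK)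
            * q ^ ((d : ℝ) / 2) * W d ω₀ ≤
        ∑ j ∈ Finset.Icc 1 d,
            (4 * RademacherChaos.kappa * q) ^ ((j : ℝ) / 2) * (∫ ω, W j ω ∂μ) := by
  open RademacherChaos in
  obtain ⟨d, rfl⟩ : ∃ m, d = m + 1 := ⟨d - 1, by omega⟩
  have hZ' : Z = fun ω => supChaos T (fun i => X i ω) := funext hZ
  have hW' : W = fun k ω => supMixed T k (fun i => X i ω) := by
    funext k ω; exact hW k ω
  subst hZ' hW'
  refine ⟨memLp_one_iff_integrable.1 (memLp_comp hX _ 1),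
    fun j _ => memLp_one_iff_integrable.1 (memLp_comp hX _ 1),
    memLp_comp hX (fun x => max (supChaos T x - ∫ ω', supChaos T (fun i => X i ω') ∂μ) 0) _,
    fun ω₀ => ?_⟩
  have hd1 : ((d + 1 : ℕ) : ℝ) - 1 = d := by push_cast; ring
  have hW : ∀ j, ∫ ω, supMixed T j (fun i => X i ω) ∂μ = 𝔼 s, supMixed T j (signs s) :=
    fun j => integral_comp hX hindep (supMixed T j)
  have hnorm : lqNorm μ q (fun ω => max (supChaos T (fun i => X i ω) -
      ∫ ω', supChaos T (fun i => X i ω') ∂μ) 0) =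
        (𝔼 s, posDev (fun s => supChaos T (signs s)) s ^ q) ^ (1 / q) := by
    rw [lqNorm, integral_comp hX hindep (supChaos T), integral_comp hX hindep
      (fun x => |max (supChaos T x - 𝔼 s, supChaos T (signs s)) 0| ^ q)]
    congr 1
    refine Finset.expect_congr rfl fun s _ => ?_
    rw [abs_of_nonneg (le_max_right _ _)]
    rfl
  simp only [hnorm, hW, hd1, Nat.add_sub_cancel, sum_Icc_one_eq_sum_range]
  refine ⟨rpow_expect_posDev_supChaos_le n hq d T hT hTne _, ?_⟩
  rw [Finset.sum_range_succ]
  refine add_le_add_right ?_ _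
  -- The top-order supremum is deterministic, so its mean is its value at any `ω₀`.
  have hconst : 𝔼 s, supMixed T (d + 1) (signs s) = supMixed T (d + 1) (fun i => X i ω₀) := by
    rw [Finset.expect_congr rfl fun s _ => supMixed_self T (signs s) (fun i => X i ω₀),
      Fintype.expect_const]
  rw [hconst]
  exact mul_le_mul_of_nonneg_right (rpow_mul_sqrt_bigK_le d (by linarith))
    (supMixed_nonneg _ _ _)
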